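/- Corollary 2.3. Let $m\ge 2$ be an integer and let $\Sigma_m=\{0,\dots,m-1\}^{\mathbb N}$ be the space of sequences $x=(x_k)_{k\ge 1}$, with the metric $\varrho(x,y)=m^{-\min\{n\ge 1:\,x_n\ne y_n\}}$ for $x\ne y$ and $\varrho(x,x)=0$. Let $r\ge 2$, let $n_1,\dots,n_r$ be distinct positive integers, and put $$X=\{x\in\Sigma_m:\ x_{kn_1}x_{kn_2}\cdots x_{kn_r}=0\ \text{ for all integers } k\ge 1\}.$$ Then the Minkowski (box-counting) dimension $\dim_M X$ exists, that is, $\log N_\varepsilon(X)/\log(1/\varepsilon)$ has a finite limit $\dim_M X$ as $\varepsilon\to 0^+$, where $N_\varepsilon(X)$ is the least number of closed balls of radius $\varepsilon$ with centres in $X$ needed to cover $X$; and the Hausdorff dimension satisfies $$\dim_H X<\dim_M X .$$ -/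

import Mathlib

open scoped NNReal ENNReal Topology

/-- The symbolic space `Σ_m = {0, …, m - 1}^ℕ` of sequences `(x_k)_{k ≥ 1}`, indexed by the
positive integers. It is a separate type, so that it does not inherit the product metric. -/
def SymbolicSpace (m : ℕ) : Type := ℕ+ → Fin m

namespace SymbolicSpace

/-- `min {n ≥ 1 : x_n ≠ y_n}`; only used when `x ≠ y`, so that the set is not empty. -/
noncomputable def firstDiff {m : ℕ} (x y : SymbolicSpace m) : ℕ :=
  sInf {n : ℕ | ∃ k : ℕ+, (k : ℕ) = n ∧ x k ≠ y k}

open Classical in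
/-- The standard metric `ϱ(x, y) = m ^ (- min {n : x_n ≠ y_n})`, and `ϱ(x, x) = 0`. -/
noncomputable def rho {m : ℕ} (x y : SymbolicSpace m) : ℝ :=
  if x = y then 0 else ((m : ℝ) ^ firstDiff x y)⁻¹

theorem firstDiff_comm {m : ℕ} (x y : SymbolicSpace m) : firstDiff x y = firstDiff y x := by
  simp only [firstDiff, ne_comm]

theorem firstDiff_spec {m : ℕ} {x y : SymbolicSpace m} (h : x ≠ y) :
    ∃ k : ℕ+, (k : ℕ) = firstDiff x y ∧ x k ≠ y k := by
  obtain ⟨k, hk⟩ := Function.ne_iff.mp h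
  exact Nat.sInf_mem (s := {n : ℕ | ∃ k : ℕ+, (k : ℕ) = n ∧ x k ≠ y k}) ⟨k, k, rfl, hk⟩

theorem firstDiff_le {m : ℕ} {x y : SymbolicSpace m} {k : ℕ+} (h : x k ≠ y k) :
    firstDiff x y ≤ k :=
  Nat.sInf_le ⟨k, rfl, h⟩

theorem one_le_base {m : ℕ} (x : SymbolicSpace m) : (1 : ℝ) ≤ m := by
  have h : 0 < m := Fin.pos (x 1)
  exact_mod_cast h

theorem rho_nonneg {m : ℕ} (x y : SymbolicSpace m) : 0 ≤ rho x y := by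
  unfold rho
  split_ifs <;> positivity

theorem rho_comm {m : ℕ} (x y : SymbolicSpace m) : rho x y = rho y x := by
  by_cases h : x = y
  · rw [h]
  · have h2 : y ≠ x := Ne.symm h
    simp only [rho, h, h2, if_false, firstDiff_comm x y]

theorem rho_triangle {m : ℕ} (x y z : SymbolicSpace m) : rho x z ≤ rho x y + rho y z := by
  have hm := one_le_base x
  by_cases hxz : x = z
  · have h0 : rho x z = 0 := by simp [rho, hxz]
    rw [h0]
    exact add_nonneg (rho_nonneg x y) (rho_nonneg y z)
  by_cases hxy : x = y
  · subst hxy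
    simp [rho]
  by_cases hyz : y = z
  · subst hyz
    simp [rho]
  obtain ⟨k, hk, hne⟩ := firstDiff_spec hxz
  have key : ∀ {a b : SymbolicSpace m}, a ≠ b → a k ≠ b k → rho x z ≤ rho a b := by
    intro a b hab hab'
    simp only [rho, hxz, hab, if_false]
    have hle : firstDiff a b ≤ firstDiff x z := hk ▸ firstDiff_le hab'
    exact inv_anti₀ (by positivity) (pow_le_pow_right₀ hm hle)
  by_cases h : x k = y k
  · have h2 : y k ≠ z k := fun e => hne (h.trans e)
    linarith [key hyz h2, rho_nonneg x y]
  · linarith [key hxy h, rho_nonneg y z]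

theorem eq_of_rho_eq_zero {m : ℕ} {x y : SymbolicSpace m} (h : rho x y = 0) : x = y := by
  by_contra hxy
  have hm := one_le_base x
  have hpos : 0 < rho x y := by
    simp only [rho, hxy, if_false]
    positivity
  exact hpos.ne' h

noncomputable instance (m : ℕ) : MetricSpace (SymbolicSpace m) where
  dist := rho
  dist_self x := by simp [rho]
  dist_comm := rho_comm
  dist_triangle := rho_triangle
  eq_of_dist_eq_zero := eq_of_rho_eq_zero

end SymbolicSpace

/-- `d` is the Minkowski (box-counting) dimension of the totally bounded set `A`:
`log N_ε(A) / log (1/ε) → d` as `ε → 0+`, where `N_ε(A)` is the least number of closed balls of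
radius `ε` with centres in `A` that cover `A` (a finite number, as `A` is totally bounded).
In particular the upper and the lower box-counting dimension of `A` agree. -/
def HasMinkowskiDim {X : Type*} [MetricSpace X] (A : Set X) (d : ℝ) : Prop :=
  TotallyBounded A ∧
    Filter.Tendsto
      (fun ε : ℝ≥0 => Real.log (Metric.coveringNumber ε A).toNat / Real.log (1 / (ε : ℝ)))
      (𝓝[>] 0) (𝓝 d)

/-- The set `X^{(m)}_{n_1, …, n_r}` of all `x ∈ Σ_m` with `x_{k n_1} ⋯ x_{k n_r} = 0` for every
`k ≥ 1`; the product is the product of integers. -/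
def multiplicativeZeroSet (m : ℕ) {r : ℕ} (n : Fin r → ℕ+) : Set (SymbolicSpace m) :=
  {x | ∀ k : ℕ+, ∏ j : Fin r, ((x (k * n j) : Fin m) : ℕ) = 0}

/-! Replace a word by the set `B` of positions of its nonzero letters. It begins a point of X
exactly when `B` contains no dilate of the pattern `a`, and with `q = m - 1` there are `q ^ #B`
words over `B`. Hence `weightSum` over `Icc 1 n` counts the admissible words of length n.

Minkowski dimension. Let P be the product of the `a j`, and S the semigroup generated by its prime
divisors. The positions split into classes kS with k coprime to P. No pattern meets two classes, so
the count factorizes (`weightSum_Icc`). Passing from n to n + 1 changes one factor only, so the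
increment of the logarithm of the count is a bounded function of the smooth part of n + 1. Such a
function has a mean value, which is the growth rate.

Hausdorff dimension. Let p be the least and M the greatest element of the pattern, and observe the
letters at positions kp for u values of k coprime to P, hence in u independent classes. Among words
so short that no pattern fits into these classes, each observed letter is nonzero with frequency
q/(1+q). Among words M times longer the pattern constrains these letters, and the frequency drops
below some f < q/(1+q) (`mul_sumWith_lt`). Fix c strictly between. A point has either at most cu or
at least cu observed nonzero letters; the first is exponentially rare at the short length, the
second at the long one (`exists_rare_families`). Covering each point by a cylinder of the length at
which it is rare saves a factor β^u, which lowers the exponent strictly (`exists_lt_tendsto_zero`).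
-/

namespace MultiplicativeShift

/-! ### Pattern-free sets and their weighted sums -/

open Finset Filter
open scoped Classical

/-- `B` contains no dilated pattern `{k a_j : j}`. -/
def PatternFree {r : ℕ} (a : Fin r → ℕ) (B : Finset ℕ) : Prop := ∀ k, ∃ j, k * a j ∉ B

/-- The sum over all pattern-free subsets of `D` of the product of the weights. -/
noncomputable def weightSum {r : ℕ} (a : Fin r → ℕ) (w : ℕ → ℝ) (D : Finset ℕ) : ℝ :=
  ∑ B ∈ D.powerset with PatternFree a B, ∏ b ∈ B, w b

variable {r : ℕ} {a : Fin r → ℕ}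

theorem PatternFree.mono {B C : Finset ℕ} (h : PatternFree a C) (hB : B ⊆ C) :
    PatternFree a B := fun k => (h k).imp fun _ hj hjB => hj (hB hjB)

theorem patternFree_empty (hr : 0 < r) : PatternFree a ∅ := fun _ => ⟨⟨0, hr⟩, by simp⟩

theorem weightSum_congr {w w' : ℕ → ℝ} {D : Finset ℕ} (h : ∀ b ∈ D, w b = w' b) :
    weightSum a w D = weightSum a w' D := by
  refine sum_congr rfl fun B hB => prod_congr rfl fun b hb => h b ?_
  exact mem_powerset.mp (mem_filter.mp hB).1 hb

theorem one_le_weightSum (hr : 0 < r) {w : ℕ → ℝ} (hw : ∀ b, 0 ≤ w b) (D : Finset ℕ) :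
    1 ≤ weightSum a w D := by
  have := single_le_sum (s := D.powerset.filter (PatternFree a)) (f := fun B => ∏ b ∈ B, w b)
    (fun B _ => prod_nonneg fun b _ => hw b) (a := ∅) (by simp [patternFree_empty hr])
  simpa [weightSum] using this

/-- Since no pattern straddles the two parts, `B` is pattern-free as soon as its two traces are, and
the traces can be chosen independently. -/
theorem weightSum_union {w : ℕ → ℝ} {D E : Finset ℕ} (hd : Disjoint D E)
    (hsep : ∀ k, (∀ j, k * a j ∈ D ∪ E) → (∀ j, k * a j ∈ D) ∨ ∀ j, k * a j ∈ E) :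
    weightSum a w (D ∪ E) = weightSum a w D * weightSum a w E := by
  unfold weightSum
  rw [sum_mul_sum, ← sum_product']
  have hdis : ∀ {B C : Finset ℕ}, B ⊆ D → C ⊆ E → Disjoint B C := fun hB hC =>
    disjoint_of_subset_left hB (disjoint_of_subset_right hC hd)
  refine sum_nbij' (fun B => (B ∩ D, B ∩ E)) (fun q => q.1 ∪ q.2) ?_ ?_ ?_ ?_ ?_
  · intro B hB
    simp only [mem_filter, mem_powerset, mem_product] at hB ⊢
    exact ⟨⟨inter_subset_right, hB.2.mono inter_subset_left⟩,
      inter_subset_right, hB.2.mono inter_subset_left⟩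
  · rintro ⟨B, C⟩ h
    simp only [mem_filter, mem_powerset, mem_product] at h ⊢
    obtain ⟨⟨hB, hBf⟩, hC, hCf⟩ := h
    refine ⟨union_subset_union hB hC, fun k => ?_⟩
    by_contra! hk
    rcases hsep k fun j => union_subset_union hB hC (hk j) with h | h
    · obtain ⟨j, hj⟩ := hBf k
      rcases mem_union.mp (hk j) with h' | h'
      · exact hj h'
      · exact disjoint_left.mp hd (h j) (hC h')
    · obtain ⟨j, hj⟩ := hCf k
      rcases mem_union.mp (hk j) with h' | h'
      · exact disjoint_left.mp hd (hB h') (h j)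
      · exact hj h'
  · intro B hB
    simp only [mem_filter, mem_powerset] at hB
    simp only [← inter_union_distrib_left, inter_eq_left.mpr hB.1]
  · rintro ⟨B, C⟩ h
    simp only [mem_filter, mem_powerset, mem_product] at h
    obtain ⟨⟨hB, -⟩, hC, -⟩ := h
    ext x <;> simp only [mem_inter, mem_union]
    · exact ⟨fun hx => hx.1.resolve_right fun h => disjoint_left.mp hd hx.2 (hC h),
        fun hx => ⟨Or.inl hx, hB hx⟩⟩
    · exact ⟨fun hx => hx.1.resolve_left fun h => disjoint_left.mp hd (hB h) hx.2,
        fun hx => ⟨Or.inr hx, hC hx⟩⟩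
  · intro B hB
    simp only [mem_filter, mem_powerset] at hB
    rw [← prod_union (hdis inter_subset_right inter_subset_right), ← inter_union_distrib_left,
      inter_eq_left.mpr hB.1]

/-- Dilation by a number coprime to the pattern does not change pattern-freeness. -/
theorem patternFree_image_mul {i : ℕ} (hi : 0 < i) (hr : 0 < r) (hco : ∀ j, i.Coprime (a j))
    (B : Finset ℕ) : PatternFree a (B.image (i * ·)) ↔ PatternFree a B := by
  constructor
  · intro h k
    obtain ⟨j, hj⟩ := h (i * k)
    exact ⟨j, fun hB => hj (mem_image.mpr ⟨_, hB, (mul_assoc _ _ _).symm⟩)⟩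
  · intro h k
    by_contra! hk
    have hdvd : i ∣ k := by
      obtain ⟨b, -, hb⟩ := mem_image.mp (hk ⟨0, hr⟩)
      exact (hco ⟨0, hr⟩).dvd_of_dvd_mul_right ⟨b, hb.symm⟩
    obtain ⟨k', rfl⟩ := hdvd
    obtain ⟨j, hj⟩ := h k'
    obtain ⟨b, hb, hb'⟩ := mem_image.mp (hk j)
    rw [mul_assoc] at hb'
    exact hj (Nat.eq_of_mul_eq_mul_left hi hb' ▸ hb)

theorem weightSum_image_mul {i : ℕ} (hi : 0 < i) (hr : 0 < r) (hco : ∀ j, i.Coprime (a j))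
    (w : ℕ → ℝ) (D : Finset ℕ) :
    weightSum a w (D.image (i * ·)) = weightSum a (fun b => w (i * b)) D := by
  have hinj : Function.Injective (i * ·) := fun x y h => Nat.eq_of_mul_eq_mul_left hi h
  unfold weightSum
  symm
  refine sum_bij (fun B _ => B.image (i * ·)) ?_ ?_ ?_ ?_
  · intro B hB
    simp only [mem_filter, mem_powerset] at hB ⊢
    exact ⟨image_subset_image hB.1, (patternFree_image_mul hi hr hco B).mpr hB.2⟩
  · intro B _ C _ h
    exact image_injective hinj h
  · intro C hC
    simp only [mem_filter, mem_powerset] at hC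
    obtain ⟨B, hB, rfl⟩ := subset_image_iff.mp hC.1
    exact ⟨B, by simpa [hB] using (patternFree_image_mul hi hr hco B).mp hC.2, rfl⟩
  · intro B _
    rw [prod_image fun x _ y _ h => hinj h]

theorem weightSum_insert {w : ℕ → ℝ} {D : Finset ℕ} {x : ℕ} (hx : x ∉ D) :
    weightSum a w (insert x D) = weightSum a w D +
      w x * ∑ B ∈ D.powerset with PatternFree a (insert x B), ∏ b ∈ B, w b := by
  unfold weightSum
  rw [sum_filter, sum_powerset_insert hx, ← sum_filter, ← sum_filter, mul_sum]
  congr 1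
  refine sum_congr rfl fun B hB => prod_insert fun h => hx ?_
  exact mem_powerset.mp (mem_filter.mp hB).1 h

theorem sum_patternFree_insert_le {w : ℕ → ℝ} (hw : ∀ b, 0 ≤ w b) (D : Finset ℕ) (x : ℕ) :
    ∑ B ∈ D.powerset with PatternFree a (insert x B), ∏ b ∈ B, w b ≤ weightSum a w D := by
  refine sum_le_sum_of_subset_of_nonneg ?_ fun B _ _ => prod_nonneg fun b _ => hw b
  exact monotone_filter_right _ fun B _ h => h.mono (subset_insert x B)

theorem sum_patternFree_insert_nonneg {w : ℕ → ℝ} (hw : ∀ b, 0 ≤ w b) (D : Finset ℕ) (x : ℕ) :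
    0 ≤ ∑ B ∈ D.powerset with PatternFree a (insert x B), ∏ b ∈ B, w b :=
  sum_nonneg fun _ _ => prod_nonneg fun b _ => hw b

/-! ### Numbers all of whose prime factors divide `P` -/

/-- The multiplicative semigroup generated by the prime divisors of `P`. -/
def IsSmooth (P s : ℕ) : Prop := ∃ e, s ∣ P ^ e

theorem IsSmooth.mul {P s t : ℕ} (hs : IsSmooth P s) (ht : IsSmooth P t) : IsSmooth P (s * t) := by
  obtain ⟨e, he⟩ := hs
  obtain ⟨f, hf⟩ := ht
  exact ⟨e + f, pow_add P e f ▸ mul_dvd_mul he hf⟩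

theorem IsSmooth.of_dvd {P s t : ℕ} (hs : IsSmooth P s) (h : t ∣ s) : IsSmooth P t :=
  hs.imp fun _ he => h.trans he

theorem isSmooth_of_dvd {P s : ℕ} (h : s ∣ P) : IsSmooth P s := ⟨1, by simpa⟩

theorem IsSmooth.coprime {P s k : ℕ} (hs : IsSmooth P s) (hk : k.Coprime P) : k.Coprime s := by
  obtain ⟨e, he⟩ := hs
  exact (hk.pow_right e).coprime_dvd_right he

theorem IsSmooth.pos {P s : ℕ} (hP : 0 < P) (hs : IsSmooth P s) : 0 < s := by
  obtain ⟨e, he⟩ := hs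
  exact Nat.pos_of_dvd_of_pos he (by positivity)

theorem exists_coprime_mul_isSmooth {P : ℕ} (b : ℕ) (hb : 0 < b) :
    ∃ k s, k.Coprime P ∧ IsSmooth P s ∧ b = k * s := by
  induction b using Nat.strong_induction_on with
  | _ b ih =>
    by_cases h : b.Coprime P
    · exact ⟨b, 1, h, ⟨0, by simp⟩, by simp⟩
    · have hg : 0 < b.gcd P := Nat.gcd_pos_of_pos_left _ hb
      have hg1 : 1 < b.gcd P := lt_of_le_of_ne hg (Ne.symm h)
      obtain ⟨c, hc⟩ := Nat.gcd_dvd_left b P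
      have hc0 : 0 < c := Nat.pos_of_ne_zero fun h0 => by simp [h0] at hc; omega
      obtain ⟨k, s, hk, hs, hcs⟩ := ih c (by rw [hc]; exact (Nat.lt_mul_iff_one_lt_left hc0).mpr hg1) hc0
      refine ⟨k, b.gcd P * s, hk, (isSmooth_of_dvd (Nat.gcd_dvd_right b P)).mul hs, ?_⟩
      rw [mul_left_comm, ← hcs, ← hc]

theorem coprime_mul_isSmooth_unique {P k k' s s' : ℕ} (hk : k.Coprime P)
    (hk' : k'.Coprime P) (hs : IsSmooth P s) (hs' : IsSmooth P s') (h : k * s = k' * s') :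
    k = k' ∧ s = s' := by
  have h1 : k ∣ k' := (hs'.coprime hk).dvd_of_dvd_mul_right ⟨s, h.symm⟩
  have h2 : k' ∣ k := (hs.coprime hk').dvd_of_dvd_mul_right ⟨s', h⟩
  have h3 := Nat.dvd_antisymm h1 h2
  subst h3
  refine ⟨rfl, ?_⟩
  -- Zero is coprime to `P` only for `P = 1`, and then 1 is the only smooth number.
  rcases Nat.eq_zero_or_pos k with rfl | hk0
  · obtain rfl : P = 1 := by simpa using hk
    obtain ⟨e, he⟩ := hs
    obtain ⟨f, hf⟩ := hs'
    rw [one_pow, Nat.dvd_one] at he hf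
    rw [he, hf]
  · exact Nat.eq_of_mul_eq_mul_left hk0 h

/-- The numbers up to `t` with all prime factors dividing `P`. -/
noncomputable def smoothUpTo (P t : ℕ) : Finset ℕ := {s ∈ Icc 1 t | IsSmooth P s}

/-- The numbers up to `n` not of the form `k s` with `s` in the semigroup generated by the prime
divisors of `P`. -/
noncomputable def outsideClass (P k n : ℕ) : Finset ℕ :=
  {b ∈ Icc 1 n | ¬∃ s, IsSmooth P s ∧ b = k * s}

theorem Icc_eq_union_class {P k : ℕ} (hk : 0 < k) (n : ℕ) :
    Icc 1 n = (smoothUpTo P (n / k)).image (k * ·) ∪ outsideClass P k n := by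
  ext b
  simp only [smoothUpTo, outsideClass, mem_union, mem_image, mem_filter, mem_Icc]
  constructor
  · intro hb
    by_cases h : ∃ s, IsSmooth P s ∧ b = k * s
    · obtain ⟨s, hs, rfl⟩ := h
      refine Or.inl ⟨s, ⟨⟨Nat.pos_of_mul_pos_left hb.1, ?_⟩, hs⟩, rfl⟩
      exact (Nat.le_div_iff_mul_le hk).mpr (by linarith [hb.2, mul_comm k s])
    · exact Or.inr ⟨hb, h⟩
  · rintro (⟨s, ⟨⟨h1, h2⟩, -⟩, rfl⟩ | h)
    · have := (Nat.le_div_iff_mul_le hk).mp h2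
      exact ⟨Nat.mul_pos hk h1, by linarith [mul_comm k s]⟩
    · exact h.1

theorem disjoint_class_outsideClass {P k : ℕ} (n t : ℕ) :
    Disjoint ((smoothUpTo P t).image (k * ·)) (outsideClass P k n) := by
  rw [disjoint_left]
  intro b hb hb'
  obtain ⟨s, hs, rfl⟩ := mem_image.mp hb
  exact (mem_filter.mp hb').2 ⟨s, (mem_filter.mp hs).2, rfl⟩

/-- Multiplication by a pattern element neither enters nor leaves a class, so all members of a
dilated pattern lie in the class of the dilation factor. -/
theorem exists_isSmooth_mul_iff {P k c l : ℕ} (hk0 : 0 < k) (hc : c ∣ P) (hk : k.Coprime P) :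
    (∃ s, IsSmooth P s ∧ l * c = k * s) ↔ ∃ s, IsSmooth P s ∧ l = k * s := by
  constructor
  · rintro ⟨s, hs, h⟩
    obtain ⟨q, rfl⟩ : k ∣ l := (hk.coprime_dvd_right hc).dvd_of_dvd_mul_right ⟨s, h⟩
    exact ⟨q, hs.of_dvd ⟨c, Nat.eq_of_mul_eq_mul_left hk0 (by rw [← h, mul_assoc])⟩, rfl⟩
  · rintro ⟨s, hs, rfl⟩
    exact ⟨s * c, hs.mul (isSmooth_of_dvd hc), mul_assoc _ _ _⟩

theorem weightSum_Icc {P k : ℕ} (hr : 0 < r) (ha : ∀ j, a j ∣ P) (hk0 : 0 < k)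
    (hk : k.Coprime P) (w : ℕ → ℝ) (n : ℕ) :
    weightSum a w (Icc 1 n) = weightSum a (fun b => w (k * b)) (smoothUpTo P (n / k)) *
      weightSum a w (outsideClass P k n) := by
  rw [Icc_eq_union_class (P := P) hk0 n, weightSum_union (disjoint_class_outsideClass n _),
    weightSum_image_mul hk0 hr fun j => hk.coprime_dvd_right (ha j)]
  intro l hl
  rw [← Icc_eq_union_class hk0 n] at hl
  by_cases h : ∃ s, IsSmooth P s ∧ l = k * s
  · left
    intro j
    have := hl j
    rw [Icc_eq_union_class (P := P) hk0 n, mem_union] at this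
    exact this.resolve_right fun h' =>
      (mem_filter.mp h').2 ((exists_isSmooth_mul_iff hk0 (ha j) hk).mpr h)
  · right
    intro j
    exact mem_filter.mpr ⟨hl j, fun h' => h ((exists_isSmooth_mul_iff hk0 (ha j) hk).mp h')⟩

/-! ### Averages of functions of the smooth part -/

theorem card_Icc_filter_eq_count (p : ℕ → Prop) (n : ℕ) :
    #{b ∈ Icc 1 n | p b} = Nat.count (fun b => p (b + 1)) n := by
  induction n with
  | zero => simp
  | succ n ih =>
    rw [Nat.count_succ, ← ih, ← insert_Icc_right_eq_Icc_add_one (by omega), filter_insert]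
    split_ifs with h
    · rw [card_insert_of_notMem (by simp)]
    · simp

/-- The deviation `u` of the count from its linear trend is periodic, hence bounded. -/
theorem exists_tendsto_count_div {p : ℕ → Prop} {q : ℕ} (hq : 0 < q)
    (hp : Function.Periodic p q) :
    ∃ L : ℝ, Tendsto (fun n : ℕ => (Nat.count p n : ℝ) / n) atTop (𝓝 L) := by
  set L : ℝ := Nat.count p q / q with hL
  have hq' : (q : ℝ) ≠ 0 := by positivity
  set u : ℕ → ℝ := fun n => Nat.count p n - n * L with hu
  have hper : Function.Periodic u q := by
    intro n
    have : Nat.count p (n + q) = Nat.count p q + Nat.count p n := by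
      rw [add_comm, Nat.count_add]
      congr 2
      ext k
      rw [add_comm, hp k]
    simp only [hu, this, hL]
    push_cast
    field_simp
    ring
  obtain ⟨C, hC⟩ : ∃ C, ∀ n, |u n| ≤ C := by
    refine ⟨∑ i ∈ range q, |u i|, fun n => ?_⟩
    rw [← hper.map_mod_nat n]
    exact single_le_sum (f := fun i => |u i|) (fun _ _ => abs_nonneg _)
      (mem_range.mpr (Nat.mod_lt n hq))
  refine ⟨L, ?_⟩
  have h0 : Tendsto (fun n : ℕ => u n / n) atTop (𝓝 0) := by
    refine squeeze_zero_norm (a := fun n : ℕ => C / n) (fun n => ?_)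
      (tendsto_const_div_atTop_nhds_zero_nat C)
    rw [Real.norm_eq_abs, abs_div, Nat.abs_cast]
    gcongr
    exact hC n
  have h1 := h0.add_const L
  rw [zero_add] at h1
  refine h1.congr' ?_
  filter_upwards [eventually_gt_atTop 0] with n hn
  have : (n : ℝ) ≠ 0 := by positivity
  simp only [hu]
  field_simp
  ring

/-- The sum is dominated by a finite Euler product over the prime divisors of `P`. -/
theorem summable_isSmooth_inv {P : ℕ} (hP : 0 < P) :
    Summable ({s | IsSmooth P s}.indicator fun s : ℕ => ((s : ℝ))⁻¹) := by
  let f : ℕ →* ℝ :=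
    { toFun := fun s => ((s : ℝ))⁻¹
      map_one' := by simp
      map_mul' := fun x y => by simp [mul_comm] }
  have h := (EulerProduct.summable_and_hasSum_factoredNumbers_prod_filter_prime_geometric
    (f := f) (fun {p} hp => by
      have : (1 : ℝ) < p := by exact_mod_cast hp.one_lt
      simpa [f] using inv_lt_one_of_one_lt₀ this) P.primeFactors).2.summable
  have h2 : Summable ((fun s : ℕ => ((s : ℝ))⁻¹) ∘
      ((↑) : (Nat.factoredNumbers P.primeFactors) → ℕ)) := h
  rw [summable_subtype_iff_indicator] at h2
  refine h2.of_nonneg_of_le (fun s => Set.indicator_nonneg (fun _ _ => by positivity) s) fun s =>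
    Set.indicator_le_indicator_of_subset ?_ (fun _ => by positivity) s
  rintro s ⟨e, he⟩
  rw [Nat.mem_factoredNumbers']
  intro p hp hps
  exact Nat.mem_primeFactors.mpr ⟨hp, hp.dvd_of_dvd_pow (hps.trans he), hP.ne'⟩

/-- Stated for every `b` so that a function can be chosen; its value at 0 is arbitrary, and averages
start at 1. -/
theorem exists_smoothPart (P b : ℕ) :
    ∃ s, 0 < b → IsSmooth P s ∧ ∃ k, k.Coprime P ∧ b = k * s := by
  rcases Nat.eq_zero_or_pos b with rfl | hb
  · exact ⟨0, by simp⟩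
  · obtain ⟨k, s, hk, hs, h⟩ := exists_coprime_mul_isSmooth (P := P) b hb
    exact ⟨s, fun _ => ⟨hs, k, hk, h⟩⟩

/-- The largest divisor of `b` with all prime factors dividing `P`. -/
noncomputable def smoothPart (P b : ℕ) : ℕ := (exists_smoothPart P b).choose

theorem smoothPart_spec {P b : ℕ} (hb : 0 < b) :
    IsSmooth P (smoothPart P b) ∧ ∃ k, k.Coprime P ∧ b = k * smoothPart P b :=
  (exists_smoothPart P b).choose_spec hb

theorem smoothPart_eq_iff {P b s : ℕ} (hb : 0 < b) (hs : IsSmooth P s) :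
    smoothPart P b = s ↔ ∃ k, k.Coprime P ∧ b = k * s := by
  obtain ⟨h1, k, hk, h⟩ := smoothPart_spec (P := P) hb
  constructor
  · rintro rfl
    exact ⟨k, hk, h⟩
  · rintro ⟨k', hk', h'⟩
    exact (coprime_mul_isSmooth_unique hk hk' h1 hs (h.symm.trans h')).2

theorem smoothPart_dvd {P b : ℕ} (hb : 0 < b) : smoothPart P b ∣ b := by
  obtain ⟨_, k, _, h⟩ := smoothPart_spec (P := P) hb
  exact ⟨k, by rw [mul_comm]; exact h⟩

theorem exists_tendsto_card_smoothPart_div {P : ℕ} (hP : 0 < P) (s : ℕ) :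
    ∃ L : ℝ, Tendsto (fun n : ℕ => (#{b ∈ Icc 1 n | smoothPart P b = s} : ℝ) / n)
      atTop (𝓝 L) := by
  by_cases hs : IsSmooth P s
  · have hs0 := hs.pos hP
    -- Adding `P * s` replaces the cofactor `k` by `k + P`. The shift `b + 1` is there because
    -- `Nat.count` starts at 0.
    have hper : Function.Periodic (fun b => ∃ k, k.Coprime P ∧ b + 1 = k * s) (P * s) := by
      intro b
      refine propext ⟨?_, ?_⟩
      · rintro ⟨k, hk, h⟩
        have hkP : P ≤ k := by
          by_contra! hlt
          have : k * s < P * s := Nat.mul_lt_mul_of_pos_right hlt hs0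
          omega
        obtain ⟨l, rfl⟩ := Nat.exists_eq_add_of_le hkP
        exact ⟨l, by simpa using hk, by linarith⟩
      · rintro ⟨k, hk, h⟩
        exact ⟨k + P, by simpa using hk, by linarith⟩
    obtain ⟨L, hL⟩ := exists_tendsto_count_div (Nat.mul_pos hP hs0) hper
    refine ⟨L, hL.congr fun n => ?_⟩
    rw [← card_Icc_filter_eq_count fun b => ∃ k, k.Coprime P ∧ b = k * s]
    congr 3
    refine filter_congr fun b hb => ?_
    exact (smoothPart_eq_iff (mem_Icc.mp hb).1 hs).symm
  · refine ⟨0, tendsto_const_nhds.congr fun n => ?_⟩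
    rw [filter_eq_empty_iff.mpr]
    · simp
    · rintro b hb rfl
      exact hs (smoothPart_spec (mem_Icc.mp hb).1).1

theorem card_smoothPart_div_le {P : ℕ} (s n : ℕ) :
    (#{b ∈ Icc 1 n | smoothPart P b = s} : ℝ) / n ≤
      {s | IsSmooth P s}.indicator (fun s : ℕ => ((s : ℝ))⁻¹) s := by
  by_cases hs : IsSmooth P s
  · rw [Set.indicator_of_mem (show s ∈ {s | IsSmooth P s} from hs)]
    have h1 : #{b ∈ Icc 1 n | smoothPart P b = s} ≤ n / s := by
      rw [← Nat.Ioc_filter_dvd_card_eq_div]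
      refine card_le_card fun b hb => ?_
      simp only [mem_filter, mem_Icc, mem_Ioc] at hb ⊢
      exact ⟨hb.1, hb.2 ▸ smoothPart_dvd hb.1.1⟩
    rcases Nat.eq_zero_or_pos n with rfl | hn
    · simp
    have hn' : (0 : ℝ) < n := by positivity
    rw [div_le_iff₀ hn']
    calc (#{b ∈ Icc 1 n | smoothPart P b = s} : ℝ) ≤ ((n / s : ℕ) : ℝ) := by exact_mod_cast h1
      _ ≤ n / s := Nat.cast_div_le
      _ = _ := by ring
  · rw [Set.indicator_of_notMem (show s ∉ {s | IsSmooth P s} from hs), filter_eq_empty_iff.mpr]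
    · simp
    · rintro b hb rfl
      exact hs (smoothPart_spec (mem_Icc.mp hb).1).1

/-- A function of the smooth part has a mean value. -/
theorem exists_tendsto_average_smoothPart {P : ℕ} (hP : 0 < P) {H : ℕ → ℝ} {C : ℝ}
    (hC : ∀ s, |H s| ≤ C) :
    ∃ L : ℝ, Tendsto (fun n : ℕ => (∑ b ∈ Icc 1 n, H (smoothPart P b)) / n) atTop (𝓝 L) := by
  choose D hD using exists_tendsto_card_smoothPart_div hP
  have hC0 : 0 ≤ C := (abs_nonneg _).trans (hC 0)
  refine ⟨∑' s, H s * D s, ?_⟩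
  -- Grouped by smooth part, the average is a sum over `s` of `H s` times a frequency, and the
  -- frequencies are at most 1/s on smooth `s`.
  have h := tendsto_tsum_of_dominated_convergence (𝓕 := atTop)
    (f := fun (n : ℕ) s => H s * ((#{b ∈ Icc 1 n | smoothPart P b = s} : ℝ) / n))
    ((summable_isSmooth_inv hP).mul_left C) (fun s => (hD s).const_mul (H s))
    (Eventually.of_forall fun n s => by
      rw [norm_mul, Real.norm_eq_abs, Real.norm_eq_abs]
      refine mul_le_mul (hC s) ?_ (abs_nonneg _) hC0
      rw [abs_of_nonneg (by positivity)]
      exact card_smoothPart_div_le s n)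
  refine h.congr fun n => ?_
  rw [sum_comp H (smoothPart P), sum_div, tsum_eq_sum (s := image (smoothPart P) (Icc 1 n))]
  · exact sum_congr rfl fun s _ => by rw [nsmul_eq_mul]; ring
  · intro s hs
    rw [filter_eq_empty_iff.mpr]
    · simp
    · rintro b hb rfl
      exact hs (mem_image_of_mem _ hb)

/-! ### The growth rate of the number of admissible words -/

theorem smoothUpTo_eq_insert {P s : ℕ} (hs0 : 0 < s) (hs : IsSmooth P s) :
    smoothUpTo P s = insert s (smoothUpTo P (s - 1)) := by
  ext b
  simp only [smoothUpTo, mem_insert, mem_filter, mem_Icc]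
  constructor
  · rintro ⟨⟨h1, h2⟩, h3⟩
    rcases eq_or_ne b s with h | h
    · exact Or.inl h
    · exact Or.inr ⟨by omega, h3⟩
  · rintro (rfl | ⟨⟨h1, h2⟩, h3⟩)
    · exact ⟨by omega, hs⟩
    · exact ⟨by omega, h3⟩

/-- With n + 1 = ks, only the class of k sees the new position; after rescaling by k its range grows
from `s - 1` to `s`. -/
theorem weightSum_Icc_succ {P : ℕ} (hr : 0 < r) (hP : 0 < P) (ha : ∀ j, a j ∣ P) (q : ℝ)
    (n : ℕ) :
    weightSum a (fun _ => q) (Icc 1 (n + 1)) *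
        weightSum a (fun _ => q) (smoothUpTo P (smoothPart P (n + 1) - 1)) =
      weightSum a (fun _ => q) (Icc 1 n) *
        weightSum a (fun _ => q) (smoothUpTo P (smoothPart P (n + 1))) := by
  obtain ⟨hs, k, hk, h⟩ := smoothPart_spec (P := P) (Nat.succ_pos n)
  set s := smoothPart P (n + 1)
  have hs0 := hs.pos hP
  have hk0 : 0 < k := Nat.pos_of_ne_zero fun h0 => by simp [h0] at h
  have h1 : (n + 1) / k = s := by rw [← Nat.succ_eq_add_one, h, Nat.mul_div_cancel_left _ hk0]
  have h2 : n / k = s - 1 := by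
    obtain ⟨t, ht⟩ : ∃ t, s = t + 1 := ⟨s - 1, by omega⟩
    rw [ht, Nat.succ_eq_add_one] at h
    rw [ht, Nat.add_sub_cancel]
    refine Nat.div_eq_of_lt_le ?_ ?_
    · nlinarith
    · nlinarith
  have h3 : outsideClass P k (n + 1) = outsideClass P k n := by
    unfold outsideClass
    rw [← insert_Icc_right_eq_Icc_add_one (by omega), filter_insert, if_neg]
    exact fun hne => hne ⟨s, hs, h⟩
  rw [weightSum_Icc hr ha hk0 hk _ (n + 1), weightSum_Icc hr ha hk0 hk _ n, h1, h2, h3]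
  ring

theorem exists_tendsto_log_weightSum_div (hr : 0 < r) (ha : ∀ j, 0 < a j) {q : ℝ} (hq : 0 ≤ q) :
    ∃ L : ℝ, Tendsto (fun n : ℕ => Real.log (weightSum a (fun _ => q) (Icc 1 n)) / n)
      atTop (𝓝 L) := by
  set P := ∏ j, a j
  have hP : 0 < P := prod_pos fun j _ => ha j
  have haP : ∀ j, a j ∣ P := fun j => dvd_prod_of_mem a (mem_univ j)
  have hpos : ∀ D, 0 < weightSum a (fun _ => q) D := fun D =>
    one_pos.trans_le (one_le_weightSum hr (fun _ => hq) D)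
  let H : ℕ → ℝ := fun s => if IsSmooth P s then
    Real.log (weightSum a (fun _ => q) (smoothUpTo P s)) -
      Real.log (weightSum a (fun _ => q) (smoothUpTo P (s - 1))) else 0
  -- One new position multiplies the sum by a factor between 1 and `1 + q`.
  have hH : ∀ s, |H s| ≤ Real.log (1 + q) := by
    intro s
    by_cases hs : IsSmooth P s
    · have hs0 := hs.pos hP
      have hnot : s ∉ smoothUpTo P (s - 1) := by
        simp only [smoothUpTo, mem_filter, mem_Icc]
        omega
      have hins := weightSum_insert (a := a) (w := fun _ => q) hnot
      rw [← smoothUpTo_eq_insert hs0 hs] at hins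
      have hn := sum_patternFree_insert_nonneg (a := a) (w := fun _ => q) (fun _ => hq)
        (smoothUpTo P (s - 1)) s
      have hl := sum_patternFree_insert_le (a := a) (w := fun _ => q) (fun _ => hq)
        (smoothUpTo P (s - 1)) s
      have p1 := hpos (smoothUpTo P s)
      have p2 := hpos (smoothUpTo P (s - 1))
      simp only [H, if_pos hs]
      rw [abs_of_nonneg]
      · rw [← Real.log_div p1.ne' p2.ne']
        refine Real.log_le_log (div_pos p1 p2) ?_
        rw [div_le_iff₀ p2, hins]
        nlinarith
      · refine sub_nonneg.mpr (Real.log_le_log p2 ?_)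
        rw [hins]
        nlinarith
    · simp only [H, if_neg hs, abs_zero]
      exact Real.log_nonneg (by linarith)
  obtain ⟨L, hL⟩ := exists_tendsto_average_smoothPart hP hH
  refine ⟨L, hL.congr fun n => ?_⟩
  congr 1
  induction n with
  | zero => simp [weightSum, sum_filter, patternFree_empty hr]
  | succ n ih =>
    rw [← insert_Icc_right_eq_Icc_add_one (by omega), sum_insert (by simp), ih,
      insert_Icc_right_eq_Icc_add_one (by omega)]
    have h := congrArg Real.log (weightSum_Icc_succ hr hP haP q n)
    rw [Real.log_mul (hpos _).ne' (hpos _).ne', Real.log_mul (hpos _).ne' (hpos _).ne'] at h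
    have hs : IsSmooth P (smoothPart P (n + 1)) := (smoothPart_spec n.succ_pos).1
    simp only [H, if_pos hs]
    linarith

/-! ### Tilted weights -/

/-- The constant weight `q`, multiplied by `θ` on the positions `k p` with `k ∈ K`. -/
noncomputable def tiltWeight (q θ : ℝ) (p : ℕ) (K : Finset ℕ) (b : ℕ) : ℝ :=
  q * if ∃ k ∈ K, b = k * p then θ else 1

/-- The tilted positions lie in different classes, so each `k` affects one factor of the product and
costs at most `ρ` there. Rescaled by `k`, that factor is tilted at `p` alone. -/
theorem weightSum_tiltWeight_le {P p n : ℕ} {q θ ρ : ℝ} (hr : 0 < r) (ha : ∀ j, a j ∣ P)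
    (hp : p ∣ P) (hq : 0 ≤ q) (hθ : 0 ≤ θ) (hρ : 0 ≤ ρ) {K : Finset ℕ}
    (hK : ∀ k ∈ K, 0 < k ∧ k.Coprime P)
    (hKρ : ∀ k ∈ K, weightSum a (tiltWeight q θ p {1}) (smoothUpTo P (n / k)) ≤
      ρ * weightSum a (fun _ => q) (smoothUpTo P (n / k))) :
    weightSum a (tiltWeight q θ p K) (Icc 1 n) ≤
      ρ ^ #K * weightSum a (fun _ => q) (Icc 1 n) := by
  induction K using Finset.induction_on with
  | empty => simp [weightSum, tiltWeight]
  | insert k K hkK ih =>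
    obtain ⟨hk0, hk⟩ := hK k (mem_insert_self k K)
    have hK' : ∀ k ∈ K, 0 < k ∧ k.Coprime P := fun l hl => hK l (mem_insert_of_mem hl)
    have ih := ih hK' fun l hl => hKρ l (mem_insert_of_mem hl)
    have hp' := isSmooth_of_dvd hp
    have e1 : weightSum a (fun b => tiltWeight q θ p (insert k K) (k * b))
        (smoothUpTo P (n / k)) = weightSum a (tiltWeight q θ p {1}) (smoothUpTo P (n / k)) := by
      refine weightSum_congr fun b hb => ?_
      have hbs := (mem_filter.mp hb).2
      unfold tiltWeight
      congr 2
      refine propext ⟨?_, ?_⟩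
      · rintro ⟨l, hl, h⟩
        refine ⟨1, mem_singleton_self 1, ?_⟩
        rw [one_mul]
        exact (coprime_mul_isSmooth_unique hk (hK l hl).2 hbs hp' h).2
      · rintro ⟨l, hl, h⟩
        rw [mem_singleton.mp hl, one_mul] at h
        exact ⟨k, mem_insert_self k K, by rw [h]⟩
    have e2 : weightSum a (fun b => tiltWeight q θ p K (k * b)) (smoothUpTo P (n / k)) =
        weightSum a (fun _ => q) (smoothUpTo P (n / k)) := by
      refine weightSum_congr fun b hb => ?_
      have hbs := (mem_filter.mp hb).2
      unfold tiltWeight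
      rw [if_neg, mul_one]
      rintro ⟨l, hl, h⟩
      exact hkK ((coprime_mul_isSmooth_unique hk (hK' l hl).2 hbs hp' h).1 ▸ hl)
    have e3 : weightSum a (tiltWeight q θ p (insert k K)) (outsideClass P k n) =
        weightSum a (tiltWeight q θ p K) (outsideClass P k n) := by
      refine weightSum_congr fun b hb => ?_
      have hbs := (mem_filter.mp hb).2
      unfold tiltWeight
      congr 2
      refine propext ⟨?_, fun ⟨l, hl, h⟩ => ⟨l, mem_insert_of_mem hl, h⟩⟩
      rintro ⟨l, hl, h⟩
      rcases mem_insert.mp hl with rfl | hl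
      · exact absurd ⟨p, hp', h⟩ hbs
      · exact ⟨l, hl, h⟩
    rw [weightSum_Icc hr ha hk0 hk (tiltWeight q θ p K), e2] at ih
    rw [weightSum_Icc hr ha hk0 hk (tiltWeight q θ p (insert k K)), e1, e3,
      card_insert_of_notMem hkK, pow_succ]
    have hw : ∀ b, 0 ≤ tiltWeight q θ p K b := fun b =>
      mul_nonneg hq (by split_ifs <;> [exact hθ; exact zero_le_one])
    have hpos := one_le_weightSum (a := a) hr hw (outsideClass P k n)
    have h1 := mul_le_mul_of_nonneg_right (hKρ k (mem_insert_self k K)) (zero_le_one.trans hpos)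
    have h2 := mul_le_mul_of_nonneg_left ih hρ
    linarith

/-- The contribution of the sets containing `p` to the weight sum over `D`, divided by `q`. -/
noncomputable def sumWith (a : Fin r → ℕ) (q : ℝ) (p : ℕ) (D : Finset ℕ) : ℝ :=
  ∑ B ∈ (D.erase p).powerset with PatternFree a (insert p B), ∏ _b ∈ B, q

theorem weightSum_eq_erase_add {q : ℝ} {p : ℕ} {D : Finset ℕ} (hp : p ∈ D) :
    weightSum a (fun _ => q) D =
      weightSum a (fun _ => q) (D.erase p) + q * sumWith a q p D := by
  rw [← insert_erase hp, weightSum_insert (notMem_erase p D), insert_erase hp, sumWith]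

theorem weightSum_tiltWeight_singleton {q θ : ℝ} {p : ℕ} {D : Finset ℕ} (hp : p ∈ D) :
    weightSum a (tiltWeight q θ p {1}) D =
      weightSum a (fun _ => q) D + (θ - 1) * (q * sumWith a q p D) := by
  have h : ∀ b ∈ D.erase p, tiltWeight q θ p {1} b = q := by
    intro b hb
    simp [tiltWeight, ne_of_mem_erase hb]
  rw [weightSum_eq_erase_add hp, ← insert_erase hp, weightSum_insert (notMem_erase p D),
    insert_erase hp, weightSum_congr h, sumWith]
  have h2 : ∑ B ∈ (D.erase p).powerset with PatternFree a (insert p B),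
      ∏ b ∈ B, tiltWeight q θ p {1} b =
      ∑ B ∈ (D.erase p).powerset with PatternFree a (insert p B), ∏ b ∈ B, q :=
    sum_congr rfl fun B hB => prod_congr rfl fun b hb =>
      h b (mem_powerset.mp (mem_filter.mp hB).1 hb)
  rw [h2]
  simp only [tiltWeight, mem_singleton, exists_eq_left, one_mul, if_true]
  ring

/-- No dilate of the pattern fits below `a i`, so the choice at `p` is free. -/
theorem mul_sumWith_eq_of_lt {P p t : ℕ} {q : ℝ} (hq : 0 ≤ q) (hp : p ∈ smoothUpTo P t)
    {i : Fin r} (ht : t < a i) :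
    q * sumWith a q p (smoothUpTo P t) =
      q / (1 + q) * weightSum a (fun _ => q) (smoothUpTo P t) := by
  have hfree : ∀ B ⊆ Icc 1 t, PatternFree a B := by
    intro B hB k
    refine ⟨i, fun hk => ?_⟩
    have := mem_Icc.mp (hB hk)
    rcases Nat.eq_zero_or_pos k with rfl | hk0
    · simp at this
    · have : a i ≤ k * a i := Nat.le_mul_of_pos_left _ hk0
      omega
  have hs : smoothUpTo P t ⊆ Icc 1 t := filter_subset _ _
  have h1 : sumWith a q p (smoothUpTo P t) =
      weightSum a (fun _ => q) ((smoothUpTo P t).erase p) := by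
    unfold sumWith weightSum
    refine sum_congr (filter_congr fun B hB => ?_) fun _ _ => rfl
    have hB' := (mem_powerset.mp hB).trans (erase_subset _ _)
    exact iff_of_true (hfree _ ((insert_subset hp hB').trans hs)) (hfree _ (hB'.trans hs))
  rw [weightSum_eq_erase_add hp, h1]
  have : 1 + q ≠ 0 := by positivity
  field_simp

theorem mul_sumWith_lt {P p t : ℕ} {q : ℝ} (hr : 0 < r) (hq : 0 < q)
    (hinj : Function.Injective a) (hP : 0 < P) (ha : ∀ j, a j ∣ P) {i : Fin r}
    (hp : a i = p) (ht : ∀ j, a j ≤ t) :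
    q * sumWith a q p (smoothUpTo P t) <
      q / (1 + q) * weightSum a (fun _ => q) (smoothUpTo P t) := by
  subst hp
  have hmem : ∀ j, a j ∈ smoothUpTo P t := fun j => mem_filter.mpr
    ⟨mem_Icc.mpr ⟨Nat.pos_of_dvd_of_pos (ha j) hP, ht j⟩, isSmooth_of_dvd (ha j)⟩
  have hlt : sumWith a q (a i) (smoothUpTo P t) <
      weightSum a (fun _ => q) ((smoothUpTo P t).erase (a i)) := by
    unfold sumWith weightSum
    -- The pattern without `a i` has too few elements to contain a dilate, but adding `a i`
    -- completes the pattern. This set makes the inequality strict.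
    set B₀ : Finset ℕ := (univ.image a).erase (a i) with hB₀
    refine sum_lt_sum_of_subset (i := B₀)
      (monotone_filter_right _ fun B _ h => h.mono (subset_insert _ B)) ?_ ?_
      (prod_pos fun _ _ => hq) fun _ _ _ => prod_nonneg fun _ _ => hq.le
    · rw [mem_filter, mem_powerset]
      refine ⟨erase_subset_erase _ fun b hb => ?_, fun k => ?_⟩
      · obtain ⟨j, -, rfl⟩ := mem_image.mp hb
        exact hmem j
      · by_contra! hk
        have hk0 : 0 < k := by
          refine Nat.pos_of_ne_zero fun h0 => ?_
          obtain ⟨j, -, hj⟩ := mem_image.mp (mem_of_mem_erase (hk i))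
          have := Nat.pos_of_dvd_of_pos (ha j) hP
          simp [h0] at hj
          omega
        have h1 : univ.image (fun j => k * a j) ⊆ B₀ := fun b hb => by
          obtain ⟨j, -, rfl⟩ := mem_image.mp hb
          exact hk j
        have h2 := card_le_card h1
        rw [card_image_of_injective _ fun x y h => hinj (Nat.eq_of_mul_eq_mul_left hk0 h), hB₀,
          card_erase_of_mem (mem_image_of_mem a (mem_univ i)), card_image_of_injective _ hinj,
          card_fin] at h2
        omega
    · rw [mem_filter, not_and]
      intro _ h
      obtain ⟨j, hj⟩ := h 1
      refine hj ?_
      rw [hB₀, insert_erase (mem_image_of_mem a (mem_univ i)), one_mul]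
      exact mem_image_of_mem a (mem_univ j)
  rw [weightSum_eq_erase_add (hmem i)]
  have h1q : 0 < 1 + q := by positivity
  rw [div_mul_eq_mul_div, lt_div_iff₀ h1q]
  nlinarith

/-! ### Large deviations -/

theorem exists_rpow_mul_lt_one_of_lt {c f : ℝ} (hc : 0 < c) (hcf : c < f) (hf : f < 1) :
    ∃ θ : ℝ, 0 < θ ∧ θ < 1 ∧ θ ^ (-c) * (1 + (θ - 1) * f) < 1 := by
  -- The bounds `1 - θ⁻¹ ≤ log θ` and `log x ≤ x - 1` bound the logarithm of the product by (1 -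
  -- θ)(c/θ - f), negative for c/f < θ < 1.
  obtain ⟨θ, h1, h2⟩ := exists_between ((div_lt_one (hc.trans hcf)).mpr hcf)
  have hf0 := hc.trans hcf
  have hθ : 0 < θ := (div_pos hc hf0).trans h1
  refine ⟨θ, hθ, h2, ?_⟩
  have hpos : 0 < 1 + (θ - 1) * f := by nlinarith
  rw [← Real.log_neg_iff (by positivity), Real.log_mul (by positivity) hpos.ne',
    Real.log_rpow hθ]
  have l1 := Real.log_le_sub_one_of_pos hpos
  have l2 := Real.one_sub_inv_le_log_of_pos hθ
  rw [div_lt_iff₀ hf0] at h1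
  have l3 : c * (θ⁻¹ - 1) < f * (1 - θ) := by
    have : c * (θ⁻¹ - 1) = c * (1 - θ) / θ := by field_simp
    rw [this, div_lt_iff₀ hθ]
    nlinarith
  nlinarith

theorem exists_rpow_mul_lt_one_of_gt {c f : ℝ} (hf : 0 < f) (hcf : f < c) :
    ∃ θ : ℝ, 1 < θ ∧ θ ^ (-c) * (1 + (θ - 1) * f) < 1 := by
  obtain ⟨θ, h1, h2⟩ := exists_between ((one_lt_div hf).mpr hcf)
  have hθ : 0 < θ := one_pos.trans h1
  refine ⟨θ, h1, ?_⟩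
  have hpos : 0 < 1 + (θ - 1) * f := by nlinarith
  rw [← Real.log_neg_iff (by positivity), Real.log_mul (by positivity) hpos.ne',
    Real.log_rpow hθ]
  have l1 := Real.log_le_sub_one_of_pos hpos
  have l2 := Real.one_sub_inv_le_log_of_pos hθ
  rw [lt_div_iff₀ hf] at h2
  have l3 : f * (θ - 1) < c * (1 - θ⁻¹) := by
    have : c * (1 - θ⁻¹) = c * (θ - 1) / θ := by field_simp
    rw [this, lt_div_iff₀ hθ]
    nlinarith
  nlinarith

/-- The number of elements of `B` of the form `k p` with `k ∈ K`. -/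
noncomputable def hits (p : ℕ) (K B : Finset ℕ) : ℕ := #{b ∈ B | ∃ k ∈ K, b = k * p}

theorem prod_tiltWeight (q θ : ℝ) (p : ℕ) (K B : Finset ℕ) :
    ∏ b ∈ B, tiltWeight q θ p K b = q ^ #B * θ ^ hits p K B := by
  simp only [tiltWeight, prod_mul_distrib, prod_const, prod_ite, one_pow, mul_one, hits]

/-- Exponential Markov inequality. It serves both tails: θ < 1 for few hits, θ > 1 for many. -/
theorem sum_pow_card_le_of_one_le_rpow {P p n : ℕ} {q θ ρ c : ℝ} (hr : 0 < r)
    (ha : ∀ j, a j ∣ P) (hp : p ∣ P) (hq : 0 ≤ q) (hθ : 0 < θ) (hρ : 0 ≤ ρ) {K : Finset ℕ}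
    (hK : ∀ k ∈ K, 0 < k ∧ k.Coprime P)
    (hKρ : ∀ k ∈ K, weightSum a (tiltWeight q θ p {1}) (smoothUpTo P (n / k)) ≤
      ρ * weightSum a (fun _ => q) (smoothUpTo P (n / k)))
    {E : Finset ℕ → Prop} (hE : ∀ B, E B → 1 ≤ θ ^ ((hits p K B : ℝ) - c * #K)) :
    ∑ B ∈ (Icc 1 n).powerset with PatternFree a B ∧ E B, q ^ #B ≤
      (θ ^ (-c) * ρ) ^ #K * weightSum a (fun _ => q) (Icc 1 n) := by
  have hθc : (θ ^ (-c)) ^ #K = θ ^ (-(c * #K)) := by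
    rw [← Real.rpow_natCast, ← Real.rpow_mul hθ.le, neg_mul]
  calc ∑ B ∈ (Icc 1 n).powerset with PatternFree a B ∧ E B, q ^ #B
      ≤ ∑ B ∈ (Icc 1 n).powerset with PatternFree a B ∧ E B,
          (θ ^ (-c)) ^ #K * ∏ b ∈ B, tiltWeight q θ p K b := by
        refine sum_le_sum fun B hB => ?_
        have h := hE B (mem_filter.mp hB).2.2
        rw [sub_eq_add_neg, Real.rpow_add hθ, Real.rpow_natCast, ← hθc] at h
        rw [prod_tiltWeight]
        nlinarith [pow_nonneg hq #B]
    _ ≤ ∑ B ∈ (Icc 1 n).powerset with PatternFree a B,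
          (θ ^ (-c)) ^ #K * ∏ b ∈ B, tiltWeight q θ p K b := by
        refine sum_le_sum_of_subset_of_nonneg
          (monotone_filter_right _ fun B _ h => h.1) fun B _ _ => ?_
        rw [prod_tiltWeight]
        positivity
    _ = (θ ^ (-c)) ^ #K * weightSum a (tiltWeight q θ p K) (Icc 1 n) := by
        rw [← mul_sum, weightSum]
    _ ≤ (θ ^ (-c)) ^ #K * (ρ ^ #K * weightSum a (fun _ => q) (Icc 1 n)) := by
        gcongr
        exact weightSum_tiltWeight_le hr ha hp hq hθ.le hρ hK hKρ
    _ = _ := by rw [mul_pow]; ring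

/-- Every set is exponentially atypical at one of the two scales `κ u`, `κ' u`. -/
theorem exists_rare_families (hr : 2 ≤ r) (ha : ∀ j, 0 < a j) (hinj : Function.Injective a)
    {q : ℝ} (hq : 0 < q) :
    ∃ β : ℝ, 0 < β ∧ β < 1 ∧ ∃ κ κ' : ℕ, 0 < κ ∧ 0 < κ' ∧ ∀ u : ℕ, ∃ E F : Finset ℕ → Prop,
      (∀ B : Finset ℕ, E (B ∩ Icc 1 (κ * u)) ∨ F (B ∩ Icc 1 (κ' * u))) ∧
      (∑ B ∈ (Icc 1 (κ * u)).powerset with PatternFree a B ∧ E B, q ^ #B ≤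
        β ^ u * weightSum a (fun _ => q) (Icc 1 (κ * u))) ∧
      ∑ B ∈ (Icc 1 (κ' * u)).powerset with PatternFree a B ∧ F B, q ^ #B ≤
        β ^ u * weightSum a (fun _ => q) (Icc 1 (κ' * u)) := by
  have hr0 : 0 < r := by omega
  set P := ∏ j, a j
  have hP : 0 < P := prod_pos fun j _ => ha j
  have haP : ∀ j, a j ∣ P := fun j => dvd_prod_of_mem a (mem_univ j)
  have hne : (univ : Finset (Fin r)).Nonempty := ⟨⟨0, hr0⟩, mem_univ _⟩
  obtain ⟨i₀, -, hmin⟩ := exists_min_image univ a hne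
  obtain ⟨i₁, -, hmax⟩ := exists_max_image univ a hne
  set p := a i₀ with hpdef
  set M := a i₁ with hMdef
  have hp0 : 0 < p := ha i₀
  have hpM : p < M := by
    refine lt_of_le_of_ne (hmin i₁ (mem_univ _)) fun h => ?_
    have h01 : (⟨0, hr0⟩ : Fin r) = ⟨1, by omega⟩ := hinj (by
      have e : ∀ j, a j = p := fun j =>
        le_antisymm ((hmax j (mem_univ j)).trans h.ge) (hmin j (mem_univ j))
      rw [e, e])
    simp at h01
  have hM0 : 0 < M := hp0.trans hpM
  have hpP : p ∣ P := haP i₀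
  have hgt : ∀ D, 0 < weightSum a (fun _ => q) D := fun D =>
    one_pos.trans_le (one_le_weightSum hr0 (fun _ => hq.le) D)
  set f₀ := q / (1 + q) with hf₀
  have hf₀0 : 0 < f₀ := by positivity
  have hf₀1 : f₀ < 1 := by rw [hf₀, div_lt_one (by positivity)]; linarith
  -- Only finitely many ranges `t` occur at the long scale, so a single `f < f₀` serves all of them.
  obtain ⟨f, ⟨hff, hf0⟩, hflt⟩ : ∃ f : ℝ, ((∀ t ∈ Icc M (M * M),
      q * sumWith a q p (smoothUpTo P t) ≤ f * weightSum a (fun _ => q) (smoothUpTo P t)) ∧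
      0 < f) ∧ f < f₀ := by
    have h1 : ∀ᶠ f in 𝓝[<] f₀, ∀ t ∈ Icc M (M * M), q * sumWith a q p (smoothUpTo P t) ≤
        f * weightSum a (fun _ => q) (smoothUpTo P t) := by
      rw [eventually_all_finset]
      intro t ht
      have h := mul_sumWith_lt hr0 hq hinj hP haP hpdef.symm
        fun j => (hmax j (mem_univ j)).trans (mem_Icc.mp ht).1
      rw [← div_lt_iff₀ (hgt _)] at h
      filter_upwards [mem_nhdsWithin_of_mem_nhds (lt_mem_nhds h)] with f hf
      exact ((div_lt_iff₀ (hgt _)).mp hf).le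
    have h2 : ∀ᶠ f in 𝓝[<] f₀, 0 < f := mem_nhdsWithin_of_mem_nhds (lt_mem_nhds hf₀0)
    exact ((h1.and h2).and self_mem_nhdsWithin).exists
  obtain ⟨c, hfc, hcf⟩ := exists_between hflt
  have hc0 : 0 < c := hf0.trans hfc
  obtain ⟨θ, hθ0, hθ1, hθ⟩ := exists_rpow_mul_lt_one_of_lt hc0 hcf hf₀1
  obtain ⟨η, hη1, hη⟩ := exists_rpow_mul_lt_one_of_gt hf0 hfc
  have hη0 : 0 < η := one_pos.trans hη1
  have hρ0 : 0 ≤ 1 + (θ - 1) * f₀ := by nlinarith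
  have hρ1 : 0 ≤ 1 + (η - 1) * f := by nlinarith
  obtain ⟨β, hβ, hβ1⟩ := exists_between (max_lt hθ (max_lt hη one_pos))
  obtain ⟨hβθ, hβη⟩ := max_lt_iff.mp hβ
  obtain ⟨hβη, hβ0⟩ := max_lt_iff.mp hβη
  refine ⟨β, hβ0, hβ1, M * p * P, M * (M * p * P), by positivity, by positivity, fun u => ?_⟩
  set n := M * p * P * u with hn
  -- Residue 1 modulo `P` gives coprimality. The offset `p * u` gives n/k < M, and p + 1 ≤ M gives
  -- kp ≤ n.
  set K : Finset ℕ := (range u).image fun v => P * (p * u + v) + 1 with hKdef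
  have hcard : #K = u := by
    rw [hKdef, card_image_of_injective, card_range]
    intro x y h
    have := Nat.eq_of_mul_eq_mul_left hP (Nat.succ_injective h)
    omega
  have hKP : ∀ k ∈ K, 0 < k ∧ k.Coprime P := by
    intro k hk
    obtain ⟨v, -, rfl⟩ := mem_image.mp hk
    exact ⟨Nat.succ_pos _, by simp⟩
  have hKlow : ∀ k ∈ K, n < k * M := by
    intro k hk
    obtain ⟨v, -, rfl⟩ := mem_image.mp hk
    calc n = (P * (p * u)) * M := by rw [hn]; ring
      _ < _ := by gcongr; exact Nat.lt_succ_of_le (by gcongr; omega)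
  have hKhigh : ∀ k ∈ K, k * p ≤ n := by
    intro k hk
    obtain ⟨v, hv, rfl⟩ := mem_image.mp hk
    have hv := mem_range.mp hv
    calc (P * (p * u + v) + 1) * p ≤ (P * (M * u)) * p := by
          gcongr
          have h1 : p * u + v + 1 ≤ M * u := by nlinarith
          calc P * (p * u + v) + 1 ≤ P * (p * u + v + 1) := by nlinarith
            _ ≤ _ := by gcongr
      _ = n := by rw [hn]; ring
  have hpmem : ∀ k ∈ K, ∀ N, n ≤ N → p ∈ smoothUpTo P (N / k) := by
    intro k hk N hN
    refine mem_filter.mpr ⟨mem_Icc.mpr ⟨hp0, ?_⟩, isSmooth_of_dvd hpP⟩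
    rw [Nat.le_div_iff_mul_le (hKP k hk).1, mul_comm]
    exact (hKhigh k hk).trans hN
  have hnN : n ≤ M * (M * p * P) * u := by
    rw [mul_assoc M]
    exact Nat.le_mul_of_pos_left _ hM0
  -- All observed positions are at most `n`, so both scales see the same number of hits and one of
  -- the two events must occur.
  have hhits : ∀ B N, n ≤ N → hits p K (B ∩ Icc 1 N) = hits p K B := by
    intro B N hN
    unfold hits
    congr 1
    ext b
    simp only [mem_filter, mem_inter, mem_Icc]
    refine ⟨fun h => ⟨h.1.1, h.2⟩, fun h => ⟨⟨h.1, ?_⟩, h.2⟩⟩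
    obtain ⟨k, hk, rfl⟩ := h.2
    exact ⟨Nat.mul_pos (hKP k hk).1 hp0, (hKhigh k hk).trans hN⟩
  refine ⟨fun B => (hits p K B : ℝ) ≤ c * #K, fun B => c * #K ≤ (hits p K B : ℝ), ?_, ?_, ?_⟩
  · intro B
    simp only [hhits B n le_rfl, hhits B _ hnN]
    exact le_total _ _
  · refine (sum_pow_card_le_of_one_le_rpow hr0 haP hpP hq.le hθ0 hρ0 hKP (fun k hk => ?_)
      (c := c) fun B hB => ?_).trans ?_
    · have hlt : n / k < a i₁ := (Nat.div_lt_iff_lt_mul (hKP k hk).1).mpr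
        (by rw [mul_comm]; exact hKlow k hk)
      rw [weightSum_tiltWeight_singleton (hpmem k hk n le_rfl),
        mul_sumWith_eq_of_lt hq.le (hpmem k hk n le_rfl) hlt]
      exact le_of_eq (by ring)
    · exact Real.one_le_rpow_of_pos_of_le_one_of_nonpos hθ0 hθ1.le (sub_nonpos.mpr hB)
    · rw [hcard]
      have := (hgt (Icc 1 n)).le
      gcongr
  · refine (sum_pow_card_le_of_one_le_rpow hr0 haP hpP hq.le hη0 hρ1 hKP (fun k hk => ?_)
      (c := c) fun B hB => ?_).trans ?_
    · have hk0 := (hKP k hk).1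
      have ht : M * (M * p * P) * u / k ∈ Icc M (M * M) := by
        have h1 := hKlow k hk
        have h2 : k ≤ n := (Nat.le_mul_of_pos_right k hp0).trans (hKhigh k hk)
        have h3 : M * (M * p * P) * u = M * n := by rw [hn]; ring
        rw [mem_Icc, h3]
        refine ⟨(Nat.le_div_iff_mul_le hk0).mpr (by gcongr), ?_⟩
        refine Nat.div_le_of_le_mul ?_
        nlinarith
      rw [weightSum_tiltWeight_singleton (hpmem k hk _ hnN)]
      have := mul_le_mul_of_nonneg_left (hff _ ht) (sub_pos.mpr hη1).le
      linarith
    · exact Real.one_le_rpow hη1.le (sub_nonneg.mpr hB)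
    · rw [hcard]
      have := (hgt (Icc 1 (M * (M * p * P) * u))).le
      gcongr

/-! ### Words and cylinders -/

/-- The word `x_1 ⋯ x_n`. -/
def word {m : ℕ} (n : ℕ) (x : SymbolicSpace m) (b : Icc 1 n) : Fin m :=
  x ⟨b, (mem_Icc.mp b.2).1⟩

/-- The positions of the nonzero letters. -/
noncomputable def wordSupport {m : ℕ} [NeZero m] {D : Finset ℕ} (w : D → Fin m) : Finset ℕ :=
  ({b | w b ≠ 0} : Finset D).map (Function.Embedding.subtype _)

/-- Extension of a word by zeros. -/
noncomputable def extendWord {m : ℕ} [NeZero m] {n : ℕ} (w : Icc 1 n → Fin m) : SymbolicSpace m :=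
  fun k => if h : (k : ℕ) ∈ Icc 1 n then w ⟨k, h⟩ else 0

variable {m : ℕ}

theorem mem_wordSupport [NeZero m] {D : Finset ℕ} {w : D → Fin m} {b : ℕ} :
    b ∈ wordSupport w ↔ ∃ h : b ∈ D, w ⟨b, h⟩ ≠ 0 := by
  simp [wordSupport]

theorem mem_wordSupport_word [NeZero m] {n : ℕ} {x : SymbolicSpace m} {k : ℕ+} :
    (k : ℕ) ∈ wordSupport (word n x) ↔ (k : ℕ) ≤ n ∧ x k ≠ 0 := by
  rw [mem_wordSupport]
  constructor
  · rintro ⟨h, hx⟩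
    exact ⟨(mem_Icc.mp h).2, hx⟩
  · rintro ⟨h, hx⟩
    exact ⟨mem_Icc.mpr ⟨k.pos, h⟩, hx⟩

theorem wordSupport_subset [NeZero m] {D : Finset ℕ} (w : D → Fin m) : wordSupport w ⊆ D := fun _ hb =>
  (mem_wordSupport.mp hb).1

theorem wordSupport_word_inter [NeZero m] {n N : ℕ} (h : n ≤ N) (x : SymbolicSpace m) :
    wordSupport (word N x) ∩ Icc 1 n = wordSupport (word n x) := by
  ext b
  simp only [mem_inter, mem_wordSupport]
  constructor
  · rintro ⟨⟨_, hx⟩, hb⟩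
    exact ⟨hb, hx⟩
  · rintro ⟨hb, hx⟩
    exact ⟨⟨Icc_subset_Icc_right h hb, hx⟩, hb⟩

@[simp]
theorem word_extendWord [NeZero m] {n : ℕ} (w : Icc 1 n → Fin m) : word n (extendWord w) = w := by
  ext b
  have : (b : ℕ) ∈ Icc 1 n := b.2
  simp [word, extendWord, this]

theorem card_wordSupport_eq [NeZero m] {D B : Finset ℕ} (hB : B ⊆ D) :
    #{w : D → Fin m | wordSupport w = B} = (m - 1) ^ #B := by
  have h : ({w : D → Fin m | wordSupport w = B} : Finset _) =
      Fintype.piFinset fun b : D => if (b : ℕ) ∈ B then univ.erase (0 : Fin m) else {0} := by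
    ext w
    simp only [mem_filter, mem_univ, true_and, Fintype.mem_piFinset]
    constructor
    · rintro rfl b
      by_cases hb : w b = 0
      · simp [mem_wordSupport, hb]
      · simp [mem_wordSupport, hb]
    · intro hw
      ext b
      rw [mem_wordSupport]
      constructor
      · rintro ⟨hb, h0⟩
        by_contra hbB
        have := hw ⟨b, hb⟩
        rw [if_neg hbB] at this
        exact h0 (mem_singleton.mp this)
      · intro hb
        have := hw ⟨b, hB hb⟩
        rw [if_pos hb] at this
        exact ⟨hB hb, ne_of_mem_erase this⟩
  rw [h, Fintype.card_piFinset]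
  have h2 : ∀ b : D, #(if (b : ℕ) ∈ B then univ.erase (0 : Fin m) else {0}) =
      if (b : ℕ) ∈ B then m - 1 else 1 := fun b => by split_ifs <;> simp
  rw [prod_congr rfl fun b _ => h2 b, prod_coe_sort D fun b => if b ∈ B then m - 1 else 1,
    prod_ite_mem, inter_eq_right.mpr hB, prod_const]

theorem card_words_eq_sum [NeZero m] (D : Finset ℕ) (Q : Finset ℕ → Prop) :
    (#{w : D → Fin m | Q (wordSupport w)} : ℝ) =
      ∑ B ∈ D.powerset with Q B, ((m : ℝ) - 1) ^ #B := by
  have hm : 1 ≤ m := NeZero.one_le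
  rw [card_eq_sum_card_fiberwise (f := wordSupport) (t := D.powerset.filter Q)]
  · push_cast
    refine sum_congr rfl fun B hB => ?_
    obtain ⟨hB, hQ⟩ := mem_filter.mp hB
    rw [filter_filter, filter_congr (q := fun w => wordSupport w = B),
      card_wordSupport_eq (mem_powerset.mp hB)]
    · push_cast [hm]
      rfl
    · rintro w -
      exact ⟨fun h => h.2, fun h => ⟨h ▸ hQ, h⟩⟩
  · intro w hw
    have := (mem_filter.mp hw).2
    exact mem_coe.mpr (mem_filter.mpr ⟨mem_powerset.mpr (wordSupport_subset w), this⟩)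

theorem card_patternFree_words [NeZero m] {r : ℕ} (a : Fin r → ℕ) (n : ℕ) :
    (#{w : Icc 1 n → Fin m | PatternFree a (wordSupport w)} : ℝ) =
      weightSum a (fun _ => (m : ℝ) - 1) (Icc 1 n) := by
  rw [card_words_eq_sum, weightSum]
  exact sum_congr rfl fun B _ => (prod_const _).symm

theorem mem_multiplicativeZeroSet_iff [NeZero m] {r : ℕ} {ν : Fin r → ℕ+} {x : SymbolicSpace m} :
    x ∈ multiplicativeZeroSet m ν ↔ ∀ k, ∃ j, x (k * ν j) = 0 := by
  have h : ∀ y : Fin m, (y : ℕ) = 0 ↔ y = 0 := fun y => by rw [Fin.ext_iff, Fin.val_zero]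
  simp only [multiplicativeZeroSet, Set.mem_ofPred_eq, prod_eq_zero_iff, mem_univ, true_and, h]

theorem patternFree_word [NeZero m] {r : ℕ} (hr : 0 < r) {ν : Fin r → ℕ+} {x : SymbolicSpace m}
    (hx : x ∈ multiplicativeZeroSet m ν) (n : ℕ) :
    PatternFree (fun j => (ν j : ℕ)) (wordSupport (word n x)) := by
  intro k
  -- `PatternFree` also tests the factor 0, harmlessly: supports of words omit 0.
  rcases Nat.eq_zero_or_pos k with rfl | hk
  · refine ⟨⟨0, hr⟩, fun h => ?_⟩
    simpa using wordSupport_subset _ h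
  · obtain ⟨j, hj⟩ := mem_multiplicativeZeroSet_iff.mp hx ⟨k, hk⟩
    refine ⟨j, fun h => ?_⟩
    rw [show k * (ν j : ℕ) = ((⟨k, hk⟩ * ν j : ℕ+) : ℕ) from rfl, mem_wordSupport_word] at h
    exact h.2 hj

theorem extendWord_mem [NeZero m] {r : ℕ} {ν : Fin r → ℕ+} {n : ℕ} {w : Icc 1 n → Fin m}
    (hw : PatternFree (fun j => (ν j : ℕ)) (wordSupport w)) :
    extendWord w ∈ multiplicativeZeroSet m ν := by
  rw [mem_multiplicativeZeroSet_iff]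
  intro k
  obtain ⟨j, hj⟩ := hw k
  refine ⟨j, ?_⟩
  by_contra hne
  unfold extendWord at hne
  split_ifs at hne with h
  · exact hj (mem_wordSupport.mpr ⟨h, hne⟩)
  · exact hne rfl

theorem dist_le_of_word_eq {n : ℕ} {x y : SymbolicSpace m} (h : word n x = word n y) :
    dist x y ≤ ((m : ℝ) ^ (n + 1))⁻¹ := by
  change SymbolicSpace.rho x y ≤ _
  unfold SymbolicSpace.rho
  split_ifs with hxy
  · positivity
  · obtain ⟨k, hk, hne⟩ := SymbolicSpace.firstDiff_spec hxy
    have hm := SymbolicSpace.one_le_base x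
    have hlt : n < k := by
      by_contra! hle
      exact hne (congrFun h ⟨k, mem_Icc.mpr ⟨k.pos, hle⟩⟩)
    rw [← hk]
    exact inv_anti₀ (by positivity) (pow_le_pow_right₀ hm hlt)

theorem word_eq_of_dist_lt {n : ℕ} {x y : SymbolicSpace m} (h : dist x y < ((m : ℝ) ^ n)⁻¹) :
    word n x = word n y := by
  by_contra hne
  obtain ⟨b, hb⟩ := Function.ne_iff.mp hne
  have hxy : x ≠ y := fun e => hne (by rw [e])
  have hm := SymbolicSpace.one_le_base x
  have hle := (SymbolicSpace.firstDiff_le hb).trans (mem_Icc.mp b.2).2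
  change SymbolicSpace.rho x y < _ at h
  simp only [SymbolicSpace.rho, hxy, if_false] at h
  exact absurd h (not_lt.mpr (inv_anti₀ (by positivity) (pow_le_pow_right₀ hm hle)))

/-! ### Covering numbers -/

theorem exists_finite_cover [NeZero m] {r : ℕ} (hr : 0 < r) (ν : Fin r → ℕ+) (n : ℕ) :
    ∃ C : Finset (SymbolicSpace m), ↑C ⊆ multiplicativeZeroSet m ν ∧
      #C ≤ #{w : Icc 1 n → Fin m | PatternFree (fun j => (ν j : ℕ)) (wordSupport w)} ∧
      ∀ x ∈ multiplicativeZeroSet m ν, ∃ y ∈ C, dist x y ≤ ((m : ℝ) ^ (n + 1))⁻¹ := by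
  refine ⟨({w : Icc 1 n → Fin m | PatternFree (fun j => (ν j : ℕ)) (wordSupport w)} :
    Finset _).image extendWord, ?_, card_image_le, ?_⟩
  · intro x hx
    obtain ⟨w, hw, rfl⟩ := mem_image.mp (mem_coe.mp hx)
    exact extendWord_mem (mem_filter.mp hw).2
  · intro x hx
    refine ⟨extendWord (word n x), mem_image_of_mem _ ?_, dist_le_of_word_eq (by simp)⟩
    exact mem_filter.mpr ⟨mem_univ _, patternFree_word hr hx n⟩

/-- Distances are 0 or integer powers of 1/m, so a closed ball of such a radius is a cylinder of
length `n`. Admissible words extend by zeros to points of X, so each needs its own ball. -/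
theorem coveringNumber_multiplicativeZeroSet [NeZero m] {r : ℕ} (hr : 0 < r) (ν : Fin r → ℕ+) {n : ℕ}
    {ε : ℝ≥0} (h1 : ((m : ℝ) ^ (n + 1))⁻¹ ≤ ε) (h2 : ε < ((m : ℝ) ^ n)⁻¹) :
    Metric.coveringNumber ε (multiplicativeZeroSet m ν) =
      #{w : Icc 1 n → Fin m | PatternFree (fun j => (ν j : ℕ)) (wordSupport w)} := by
  apply le_antisymm
  · obtain ⟨C, hCX, hcard, hC⟩ := exists_finite_cover (m := m) hr ν n
    have hcov : Metric.IsCover ε (multiplicativeZeroSet m ν) (C : Set (SymbolicSpace m)) := by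
      rw [Metric.isCover_iff_subset_iUnion_closedBall]
      intro x hx
      obtain ⟨y, hy, hxy⟩ := hC x hx
      exact Set.mem_biUnion (mem_coe.mpr hy) (Metric.mem_closedBall.mpr (hxy.trans h1))
    refine (hcov.coveringNumber_le_encard hCX).trans ?_
    rw [Set.encard_coe_eq_coe_finsetCard]
    exact_mod_cast hcard
  · unfold Metric.coveringNumber
    refine le_iInf fun C => le_iInf fun hCX => le_iInf fun hC => ?_
    rw [← Set.encard_coe_eq_coe_finsetCard]
    refine (Set.encard_le_encard (t := word n '' C) fun w hw => ?_).trans (Set.encard_image_le _ _)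
    have hw := (mem_filter.mp (mem_coe.mp hw)).2
    rw [Metric.isCover_iff_subset_iUnion_closedBall] at hC
    obtain ⟨y, hy, hxy⟩ := Set.mem_iUnion₂.mp (hC (extendWord_mem hw))
    refine ⟨y, hy, ?_⟩
    rw [← word_extendWord w]
    refine word_eq_of_dist_lt ?_
    rw [dist_comm]
    exact (Metric.mem_closedBall.mp hxy).trans_lt h2

theorem totallyBounded_multiplicativeZeroSet [NeZero m] {r : ℕ} (hr : 0 < r) (hm : 2 ≤ m)
    (ν : Fin r → ℕ+) : TotallyBounded (multiplicativeZeroSet m ν) := by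
  rw [Metric.totallyBounded_iff]
  intro ε hε
  have hm1 : (1 : ℝ) < m := by exact_mod_cast hm
  obtain ⟨n, hn⟩ := exists_pow_lt_of_lt_one hε (inv_lt_one_of_one_lt₀ hm1)
  obtain ⟨C, -, -, hC⟩ := exists_finite_cover (m := m) hr ν n
  refine ⟨C, C.finite_toSet, fun x hx => ?_⟩
  obtain ⟨y, hy, hxy⟩ := hC x hx
  refine Set.mem_biUnion (mem_coe.mpr hy) (Metric.mem_ball.mpr (hxy.trans_lt ?_))
  refine lt_of_le_of_lt ?_ hn
  rw [inv_pow]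
  exact inv_anti₀ (by positivity) (pow_le_pow_right₀ hm1.le (Nat.le_succ n))

theorem hasMinkowskiDim_multiplicativeZeroSet [NeZero m] {r : ℕ} (hr : 0 < r) (hm : 2 ≤ m)
    (ν : Fin r → ℕ+) {L : ℝ}
    (hL : Tendsto (fun n : ℕ => Real.log (weightSum (fun j => (ν j : ℕ))
      (fun _ => (m : ℝ) - 1) (Icc 1 n)) / n) atTop (𝓝 L)) :
    HasMinkowskiDim (multiplicativeZeroSet m ν) (L / Real.log m) := by
  refine ⟨totallyBounded_multiplicativeZeroSet hr hm ν, ?_⟩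
  have hm1 : (1 : ℝ) < m := by exact_mod_cast hm
  have hm0 : (0 : ℝ) < m := one_pos.trans hm1
  have hlog : 0 < Real.log m := Real.log_pos hm1
  set T : ℝ≥0 → ℝ := fun ε => Real.log (1 / (ε : ℝ)) / Real.log m with hT
  have hTlim : Tendsto T (𝓝[>] 0) atTop := by
    refine Tendsto.atTop_div_const hlog (Real.tendsto_log_atTop.comp ?_)
    have h0 : Tendsto (fun ε : ℝ≥0 => (ε : ℝ)) (𝓝[>] 0) (𝓝[>] 0) := by
      refine tendsto_nhdsWithin_iff.mpr ⟨?_, ?_⟩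
      · exact (NNReal.continuous_coe.tendsto' 0 0 rfl).mono_left nhdsWithin_le_nhds
      · filter_upwards [self_mem_nhdsWithin] with ε hε
        exact NNReal.coe_pos.mpr hε
    simp only [one_div]
    exact tendsto_inv_nhdsGT_zero.comp h0
  -- This is the word length with N < T ≤ N + 1, as the covering count requires.
  set N : ℝ≥0 → ℕ := fun ε => ⌈T ε⌉₊ - 1 with hN
  have hNlim : Tendsto N (𝓝[>] 0) atTop :=
    (tendsto_sub_atTop_nat 1).comp (tendsto_nat_ceil_atTop.comp hTlim)
  have hTpos : ∀ᶠ ε in 𝓝[>] (0 : ℝ≥0), 0 < T ε := hTlim.eventually_gt_atTop 0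
  have hNcast : ∀ ε, 0 < T ε → (N ε : ℝ) = ⌈T ε⌉₊ - 1 := fun ε hε => by
    have : 1 ≤ ⌈T ε⌉₊ := Nat.one_le_ceil_iff.mpr hε
    simp [hN, Nat.cast_sub this]
  have hratio : Tendsto (fun ε => (N ε : ℝ) / T ε) (𝓝[>] 0) (𝓝 1) := by
    have h1 := ((tendsto_nat_ceil_div_atTop (R := ℝ)).comp hTlim).sub
      (tendsto_inv_atTop_zero.comp hTlim)
    rw [sub_zero] at h1
    refine h1.congr' ?_
    filter_upwards [hTpos] with ε hε
    simp only [Function.comp, hNcast ε hε]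
    ring
  have hmain := ((hL.comp hNlim).mul hratio).div_const (Real.log m)
  rw [mul_one] at hmain
  refine hmain.congr' ?_
  filter_upwards [hTpos, hNlim.eventually_gt_atTop 0, self_mem_nhdsWithin] with ε hε hNε hε0
  have hε0 : (0 : ℝ) < ε := NNReal.coe_pos.mpr hε0
  have hlogε : Real.log (1 / (ε : ℝ)) = T ε * Real.log m := by
    simp only [hT]
    field_simp
  have hεexp : (ε : ℝ) = Real.exp (-(T ε * Real.log m)) := by
    rw [← hlogε, one_div, Real.log_inv, neg_neg, Real.exp_log hε0]
  have hpow : ∀ k : ℕ, ((m : ℝ) ^ k)⁻¹ = Real.exp (-(k * Real.log m)) := fun k => by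
    rw [Real.exp_neg, Real.exp_nat_mul, Real.exp_log hm0]
  have h1 : ((m : ℝ) ^ (N ε + 1))⁻¹ ≤ ε := by
    rw [hpow, hεexp, Real.exp_le_exp, neg_le_neg_iff]
    push_cast
    rw [hNcast ε hε, sub_add_cancel]
    gcongr
    exact Nat.le_ceil _
  have h2 : (ε : ℝ) < ((m : ℝ) ^ N ε)⁻¹ := by
    rw [hpow, hεexp, Real.exp_lt_exp, neg_lt_neg_iff]
    rw [hNcast ε hε]
    gcongr
    have := Nat.ceil_lt_add_one hε.le
    linarith
  rw [coveringNumber_multiplicativeZeroSet hr ν h1 h2, ENat.toNat_natCast, card_patternFree_words,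
    hlogε]
  have : (N ε : ℝ) ≠ 0 := by positivity
  simp only [Function.comp]
  field_simp

/-! ### The Hausdorff dimension -/

theorem exists_lt_tendsto_zero {c : ℕ → ℝ} (hc : ∀ n, 0 < c n) {L : ℝ}
    (hL : Tendsto (fun n : ℕ => Real.log (c n) / n) atTop (𝓝 L)) {β : ℝ} (hβ0 : 0 < β)
    (hβ1 : β < 1) {κ : ℕ} (hκ : 0 < κ) {M : ℝ} (hM : 1 < M) :
    ∃ d < L / Real.log M, ∀ s, d ≤ s → Tendsto
      (fun u : ℕ => β ^ u * c (κ * u) * (((M ^ (κ * u))⁻¹) ^ s)) atTop (𝓝 0) := by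
  have hlogM := Real.log_pos hM
  have hlogβ := Real.log_neg hβ0 hβ1
  have hM0 : 0 < M := one_pos.trans hM
  have hκ0 : (0 : ℝ) < κ := by exact_mod_cast hκ
  -- Half of the gain from β^u lowers the exponent; the other half leaves the decay rate `log β / 2`
  -- per unit of `u`.
  refine ⟨L / Real.log M + Real.log β / (2 * κ * Real.log M), ?_, fun s hs => ?_⟩
  · have : Real.log β / (2 * κ * Real.log M) < 0 := div_neg_of_neg_of_pos hlogβ (by positivity)
    linarith
  have hlim : Tendsto (fun u : ℕ => Real.log β + κ * (Real.log (c (κ * u)) / (κ * u : ℕ)) -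
      κ * s * Real.log M) atTop (𝓝 (Real.log β + κ * L - κ * s * Real.log M)) := by
    have hmul : Tendsto (fun u : ℕ => κ * u) atTop atTop := tendsto_id.const_mul_atTop' hκ
    exact (((hL.comp hmul).const_mul (κ : ℝ)).const_add _).sub_const _
  have hneg : Real.log β + κ * L - κ * s * Real.log M < 0 := by
    have h1 := mul_le_mul_of_nonneg_left hs (mul_pos hκ0 hlogM).le
    have h2 : κ * Real.log M * (L / Real.log M + Real.log β / (2 * κ * Real.log M)) =
        κ * L + Real.log β / 2 := by field_simp
    rw [h2] at h1
    nlinarith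
  have h3 := Real.tendsto_exp_atBot.comp
    ((tendsto_natCast_atTop_atTop (R := ℝ)).atTop_mul_neg hneg hlim)
  refine h3.congr' ?_
  filter_upwards [eventually_gt_atTop 0] with u hu
  have hu0 : (u : ℝ) ≠ 0 := by positivity
  have hp : 0 < (M ^ (κ * u))⁻¹ := by positivity
  rw [Real.rpow_def_of_pos hp, Real.log_inv, Real.log_pow]
  rw [← Real.exp_log hβ0]
  rw [← Real.exp_log (hc (κ * u))]
  rw [← Real.exp_nat_mul, ← Real.exp_add, ← Real.exp_add]
  simp only [Function.comp, Real.log_exp]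
  congr 1
  push_cast
  field_simp
  ring

theorem ediam_word_fiber_le (n : ℕ) (w : Icc 1 n → Fin m) (hm : 1 ≤ m) :
    Metric.ediam {x | word n x = w} ≤ ENNReal.ofReal ((m : ℝ) ^ n)⁻¹ := by
  have hm1 : (1 : ℝ) ≤ m := by exact_mod_cast hm
  refine Metric.ediam_le fun x hx y hy => ?_
  rw [edist_dist]
  refine ENNReal.ofReal_le_ofReal ((dist_le_of_word_eq (hx.trans hy.symm)).trans ?_)
  exact inv_anti₀ (by positivity) (pow_le_pow_right₀ hm1 (Nat.le_succ n))

/-- If each point of `A` has, for all `u`, its word of length `κ u` in `U u` or its word of length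
`κ' u` in `V u`, then the cardinalities of these sets bound the Hausdorff dimension. -/
theorem dimH_le_of_words (hm : 2 ≤ m) {A : Set (SymbolicSpace m)} {κ κ' : ℕ} (hκ : 0 < κ)
    (hκ' : 0 < κ') (U : ∀ u, Finset (Icc 1 (κ * u) → Fin m))
    (V : ∀ u, Finset (Icc 1 (κ' * u) → Fin m))
    (hA : ∀ u, ∀ x ∈ A, word (κ * u) x ∈ U u ∨ word (κ' * u) x ∈ V u) {s : ℝ} (hs : 0 ≤ s)
    (hlim : Tendsto (fun u : ℕ => #(U u) * (((m : ℝ) ^ (κ * u))⁻¹) ^ s +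
      #(V u) * (((m : ℝ) ^ (κ' * u))⁻¹) ^ s) atTop (𝓝 0)) :
    dimH A ≤ ENNReal.ofReal s := by
  borelize (SymbolicSpace m)
  have hm1 : (1 : ℝ) < m := by exact_mod_cast hm
  have hm0 : (0 : ℝ) < m := one_pos.trans hm1
  refine dimH_le_of_hausdorffMeasure_ne_top (d := s.toNNReal) ?_
  rw [Real.coe_toNNReal s hs]
  let t : ∀ u : ℕ, (U u) ⊕ (V u) → Set (SymbolicSpace m) := fun u =>
    Sum.elim (fun w => {x | word (κ * u) x = w.1}) (fun w => {x | word (κ' * u) x = w.1})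
  have hpow : ∀ {k : ℕ}, 0 < k → ∀ u, ((m : ℝ) ^ (k * u))⁻¹ ≤ ((m : ℝ)⁻¹) ^ u := by
    intro k hk u
    rw [inv_pow]
    exact inv_anti₀ (by positivity) (pow_le_pow_right₀ hm1.le (Nat.le_mul_of_pos_left u hk))
  have hle := MeasureTheory.Measure.hausdorffMeasure_le_liminf_sum s A (l := atTop)
    (fun u : ℕ => ENNReal.ofReal (((m : ℝ)⁻¹) ^ u)) (by
      rw [← ENNReal.ofReal_zero]
      exact ENNReal.tendsto_ofReal (tendsto_pow_atTop_nhds_zero_of_lt_one (by positivity)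
        (inv_lt_one_of_one_lt₀ hm1))) t (Eventually.of_forall fun u => by
      rintro (w | w)
      · exact (ediam_word_fiber_le _ w.1 (by omega)).trans (ENNReal.ofReal_le_ofReal (hpow hκ u))
      · exact (ediam_word_fiber_le _ w.1 (by omega)).trans (ENNReal.ofReal_le_ofReal (hpow hκ' u)))
    (Eventually.of_forall fun u x hx => by
      rcases hA u x hx with h | h
      · exact Set.mem_iUnion.mpr ⟨Sum.inl ⟨_, h⟩, rfl⟩
      · exact Set.mem_iUnion.mpr ⟨Sum.inr ⟨_, h⟩, rfl⟩)
  have hsum : ∀ u, ∑ i, Metric.ediam (t u i) ^ s ≤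
      ENNReal.ofReal (#(U u) * (((m : ℝ) ^ (κ * u))⁻¹) ^ s +
        #(V u) * (((m : ℝ) ^ (κ' * u))⁻¹) ^ s) := by
    intro u
    have hb : ∀ {ι : Type} (n : ℕ) (S : Finset ι) (g : S → Set (SymbolicSpace m)),
        (∀ i, Metric.ediam (g i) ≤ ENNReal.ofReal ((m : ℝ) ^ n)⁻¹) →
        ∑ i, Metric.ediam (g i) ^ s ≤ ENNReal.ofReal (#S * (((m : ℝ) ^ n)⁻¹) ^ s) := by
      intro ι n S g hg
      calc ∑ i, Metric.ediam (g i) ^ s ≤ ∑ _i : S, ENNReal.ofReal ((((m : ℝ) ^ n)⁻¹) ^ s) := by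
            refine sum_le_sum fun i _ => ?_
            rw [← ENNReal.ofReal_rpow_of_nonneg (by positivity) hs]
            exact ENNReal.rpow_le_rpow (hg i) hs
        _ = _ := by
            rw [sum_const, nsmul_eq_mul, card_univ, Fintype.card_coe,
              ENNReal.ofReal_mul (by positivity), ENNReal.ofReal_natCast]
    rw [Fintype.sum_sum_type, ENNReal.ofReal_add (by positivity) (by positivity)]
    exact add_le_add (hb _ _ _ fun w => ediam_word_fiber_le _ w.1 (by omega))
      (hb _ _ _ fun w => ediam_word_fiber_le _ w.1 (by omega))
  have h0 : Tendsto (fun u => ∑ i, Metric.ediam (t u i) ^ s) atTop (𝓝 0) := by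
    refine tendsto_of_tendsto_of_tendsto_of_le_of_le tendsto_const_nhds ?_
      (fun _ => zero_le) hsum
    simpa using ENNReal.tendsto_ofReal hlim
  rw [h0.liminf_eq] at hle
  exact (hle.trans_lt ENNReal.zero_lt_top).ne

theorem dimH_multiplicativeZeroSet_lt {m : ℕ} [NeZero m] (hm : 2 ≤ m) {r : ℕ} (hr : 2 ≤ r)
    {ν : Fin r → ℕ+} (hν : Function.Injective ν) {L : ℝ}
    (hL : Tendsto (fun n : ℕ => Real.log (weightSum (fun j => (ν j : ℕ))
      (fun _ => (m : ℝ) - 1) (Icc 1 n)) / n) atTop (𝓝 L)) :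
    dimH (multiplicativeZeroSet m ν) < ENNReal.ofReal (L / Real.log m) := by
  have hm1 : (1 : ℝ) < m := by exact_mod_cast hm
  have hm0 : (0 : ℝ) < m := one_pos.trans hm1
  have hr0 : 0 < r := by omega
  set a : Fin r → ℕ := fun j => (ν j : ℕ) with ha
  have hq : 0 < (m : ℝ) - 1 := sub_pos.mpr hm1
  obtain ⟨β, hβ0, hβ1, κ, κ', hκ, hκ', H⟩ := exists_rare_families (a := a) hr
    (fun j => (ν j).pos) (fun x y h => hν (PNat.coe_injective h)) hq
  choose E F hEF hE hF using H
  have hc : ∀ n, 0 < weightSum a (fun _ => (m : ℝ) - 1) (Icc 1 n) := fun n =>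
    one_pos.trans_le (one_le_weightSum hr0 (fun _ => hq.le) _)
  obtain ⟨d₁, hd₁, h₁⟩ := exists_lt_tendsto_zero hc hL hβ0 hβ1 hκ hm1
  obtain ⟨d₂, hd₂, h₂⟩ := exists_lt_tendsto_zero hc hL hβ0 hβ1 hκ' hm1
  set s := max d₁ d₂
  have hsd : s < L / Real.log m := max_lt hd₁ hd₂
  let U : ∀ u, Finset (Icc 1 (κ * u) → Fin m) := fun u =>
    {w | PatternFree a (wordSupport w) ∧ E u (wordSupport w)}
  let V : ∀ u, Finset (Icc 1 (κ' * u) → Fin m) := fun u =>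
    {w | PatternFree a (wordSupport w) ∧ F u (wordSupport w)}
  have hlim : Tendsto (fun u : ℕ => #(U u) * (((m : ℝ) ^ (κ * u))⁻¹) ^ s +
      #(V u) * (((m : ℝ) ^ (κ' * u))⁻¹) ^ s) atTop (𝓝 0) := by
    have h := (h₁ s (le_max_left _ _)).add (h₂ s (le_max_right _ _))
    rw [add_zero] at h
    refine tendsto_of_tendsto_of_tendsto_of_le_of_le tendsto_const_nhds h
      (fun u => by positivity) fun u => ?_
    have e₁ := card_words_eq_sum (m := m) (Icc 1 (κ * u)) fun B => PatternFree a B ∧ E u B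
    have e₂ := card_words_eq_sum (m := m) (Icc 1 (κ' * u)) fun B => PatternFree a B ∧ F u B
    refine add_le_add (mul_le_mul_of_nonneg_right ?_ (by positivity))
      (mul_le_mul_of_nonneg_right ?_ (by positivity))
    · refine (le_of_eq ?_).trans (hE u)
      convert e₁
    · refine (le_of_eq ?_).trans (hF u)
      convert e₂
  have hA : ∀ u, ∀ x ∈ multiplicativeZeroSet m ν,
      word (κ * u) x ∈ U u ∨ word (κ' * u) x ∈ V u := by
    intro u x hx
    -- The dichotomy needs one finite set whose truncations are the supports of both words.
    have h := hEF u (wordSupport (word (max (κ * u) (κ' * u)) x))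
    rw [wordSupport_word_inter (le_max_left _ _), wordSupport_word_inter (le_max_right _ _)] at h
    exact h.imp (fun h => mem_filter.mpr ⟨mem_univ _, patternFree_word hr0 hx _, h⟩)
      fun h => mem_filter.mpr ⟨mem_univ _, patternFree_word hr0 hx _, h⟩
  -- For s ≤ 0 every cylinder contributes at least 1, and the zero sequence always needs one,
  -- against the limit 0.
  have hs : 0 < s := by
    by_contra! hs
    have hx : (extendWord (fun _ => 0 : Icc 1 0 → Fin m)) ∈ multiplicativeZeroSet m ν :=
      extendWord_mem fun k => ⟨⟨0, hr0⟩, by simp [wordSupport]⟩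
    obtain ⟨u, hu⟩ := (hlim.eventually (gt_mem_nhds one_pos)).exists
    have hone : ∀ k : ℕ, 1 ≤ (((m : ℝ) ^ k)⁻¹) ^ s := fun k =>
      Real.one_le_rpow_of_pos_of_le_one_of_nonpos (by positivity)
        (inv_le_one_of_one_le₀ (one_le_pow₀ hm1.le)) hs
    have hU := hone (κ * u)
    have hV := hone (κ' * u)
    rcases hA u _ hx with h | h
    · have : (1 : ℝ) ≤ #(U u) := by exact_mod_cast card_pos.mpr ⟨_, h⟩
      have h' : 0 ≤ #(V u) * (((m : ℝ) ^ (κ' * u))⁻¹) ^ s := by positivity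
      nlinarith
    · have : (1 : ℝ) ≤ #(V u) := by exact_mod_cast card_pos.mpr ⟨_, h⟩
      have h' : 0 ≤ #(U u) * (((m : ℝ) ^ (κ * u))⁻¹) ^ s := by positivity
      nlinarith
  refine (dimH_le_of_words hm hκ hκ' U V hA hs.le hlim).trans_lt ?_
  exact (ENNReal.ofReal_lt_ofReal_iff (hs.trans hsd)).mpr hsd

end MultiplicativeShift

theorem corollary2p3 (m : ℕ) (hm : 2 ≤ m) (r : ℕ) (hr : 2 ≤ r) (n : Fin r → ℕ+)
    (hn : Function.Injective n) :
    ∃ d : ℝ, HasMinkowskiDim (multiplicativeZeroSet m n) d ∧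
      dimH (multiplicativeZeroSet m n) < ENNReal.ofReal d := by
  have : NeZero m := ⟨by omega⟩
  have hq : (0 : ℝ) ≤ (m : ℝ) - 1 := sub_nonneg.mpr (by exact_mod_cast (by omega : 1 ≤ m))
  obtain ⟨L, hL⟩ := MultiplicativeShift.exists_tendsto_log_weightSum_div
    (a := fun j => (n j : ℕ)) (by omega : 0 < r) (fun j => (n j).pos) hq
  exact ⟨L / Real.log m,
    MultiplicativeShift.hasMinkowskiDim_multiplicativeZeroSet (by omega) hm n hL,
    MultiplicativeShift.dimH_multiplicativeZeroSet_lt hm hr hn hL⟩
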